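/- Let $m,n$ be non-negative integers, let $A\in\mathbb R^{m\times n}$ be a random matrix with independent $\mathcal N(0,1)$ entries, let $x\in\mathbb R^n$ be a fixed vector, let $f:\mathbb R^n\to\mathbb R$ be a function whose sublevel sets $\{z: f(z)\le r\}$ are all closed, and let $\eta\ge 0$. Put $\kappa_f=1$ if $f$ is convex and $\kappa_f=2$ otherwise. For $u\in\mathbb R^n$ let $\mathcal C_f(u)$ be the smallest closed (not necessarily convex) cone containing $\{h: f(u+h)\le f(u)\}$, let $\omega(S)=\mathbb E\sup_{z\in S}\langle g,z\rangle$ with $g\sim\mathcal N(0,I_n)$, let $\phi(t)=\sqrt2\,\Gamma(\frac{t+1}{2})/\Gamma(\frac t2)$ for $t\ge0$ (with $\phi(0)=0$), let $\phi^{-1}:[0,\infty)\to[0,\infty)$ be its inverse, and let $$\mathcal M(f,u,\eta)=\phi^{-1}\big(\omega(\mathcal C_f(u)\cap\mathcal B^n)+\eta\big),$$ where $\mathcal B^n$ is the closed Euclidean unit ball. Put $m_0=\mathcal M(f,x,\eta)$, $b_m=\phi(m)$, and assume $$m>8\kappa_f^2m_0 .$$ For $R\in\mathbb R$ let $\mathcal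 K=\{z\in\mathbb R^n: f(z)\le R\}$, let $\mathcal P_{\mathcal K}(v)$ denote a point of $\mathcal K$ nearest to $v$ in the Euclidean norm $\|\cdot\|$, and consider the projected gradient iteration with $y=Ax$ and $\mu=1/b_m^2$, $$z_0=0,\qquad z_{\tau+1}=\mathcal P_{\mathcal K}\big(z_\tau+\mu A^*(y-Az_\tau)\big),$$ where any nearest point may be chosen at each step. (1) There is an event of probability at least $1-8e^{-\eta^2/8}$ on which, for all $R<f(x)$ (with $\mathcal K\neq\emptyset$), all such sequences $(z_\tau)$ and all $\tau\ge0$, $$\|z_\tau-x\|\le\rho^\tau\|x\|+\frac{3-\kappa_f}{1-\rho}\,\|x-\mathcal P_{\mathcal K}(x)\|,\qquad \rho=\sqrt8\,\kappa_f\sqrt{\frac{m_0}{m}} .$$ (2) If moreover $f$ is absolutely homogeneous, i.e. $f(cz)=|c|f(z)$ for all $c\in\mathbb R$ and $z\in\mathbb R^n$, and $f(x)>0$, then there is an event of probability at least $1-8e^{-\eta^2/8}$ on which, for all $R>f(x)$, all such sequences $(z_\tau)$ and all $\tau\ge0$, $$\|z_\tau-x\|\le\rho^\tau\|x\|+\frac{\kappa_f+1+2\rho}{1-\rho}\Big(\frac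 R{f(x)}-1\Big)\|x\|,\qquad \rho=\sqrt8\,\kappa_f\sqrt{\frac{m_0'}{m}},\quad m_0'=\mathcal M\Big(f,\tfrac{R}{f(x)}x,\eta\Big).$$ (3) If $f$ is a norm and $x\ne0$, then $m_0'=m_0$ for all $R>f(x)$. -/

import Mathlib

open MeasureTheory ProbabilityTheory Set

noncomputable section

namespace PGD

/-- `ℝⁿ` with the Euclidean norm. -/
abbrev Vec (n : ℕ) := EuclideanSpace ℝ (Fin n)

/-- A proper function, in the sense that all its sublevel sets are closed. -/
def IsProperFun {n : ℕ} (f : Vec n → ℝ) : Prop :=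
  ∀ r : ℝ, IsClosed {z : Vec n | f z ≤ r}

/-- Absolute homogeneity: `f (c z) = |c| f z`. -/
def AbsHomogeneous {n : ℕ} (f : Vec n → ℝ) : Prop :=
  ∀ (c : ℝ) (z : Vec n), f (c • z) = |c| * f z

/-- The descent set of `f` at `x`. -/
def descentSet {n : ℕ} (f : Vec n → ℝ) (x : Vec n) : Set (Vec n) :=
  {h | f (x + h) ≤ f x}

/-- Closed cones (not necessarily convex). -/
def IsClosedCone {n : ℕ} (C : Set (Vec n)) : Prop :=
  IsClosed C ∧ ∀ t : ℝ, 0 ≤ t → ∀ h ∈ C, t • h ∈ C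

/-- The tangent cone of `f` at `x`: the smallest closed cone containing the descent set. -/
def tangentCone {n : ℕ} (f : Vec n → ℝ) (x : Vec n) : Set (Vec n) :=
  ⋂₀ {C | IsClosedCone C ∧ descentSet f x ⊆ C}

/-- The Gaussian width `E sup_{z ∈ S} ⟨g, z⟩`, `g` standard Gaussian in `ℝⁿ`. -/
def gaussianWidth {n : ℕ} (S : Set (Vec n)) : ℝ :=
  ∫ g, sSup ((fun z : Vec n => inner ℝ g z) '' S) ∂(stdGaussian (Vec n))

/-- `φ(t) = √2 Γ((t+1)/2) / Γ(t/2)`; at `t = 0` the value is `0`, its continuous extension. -/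
def phi (t : ℝ) : ℝ :=
  Real.sqrt 2 * Real.Gamma ((t + 1) / 2) / Real.Gamma (t / 2)

/-- The inverse of `φ : [0, ∞) → [0, ∞)`. -/
def phiInv (s : ℝ) : ℝ :=
  Function.invFunOn phi (Ici 0) s

/-- The phase transition function `M(f, x, η) = φ⁻¹(ω(C_f(x) ∩ Bⁿ) + η)`. -/
def phaseTransition {n : ℕ} (f : Vec n → ℝ) (x : Vec n) (η : ℝ) : ℝ :=
  phiInv (gaussianWidth (tangentCone f x ∩ Metric.closedBall 0 1) + η)

open Classical in
/-- `κ_f`: `1` for convex `f` and `2` for non-convex `f`. -/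
def kappa {n : ℕ} (f : Vec n → ℝ) : ℝ :=
  if ConvexOn ℝ univ f then 1 else 2

/-- `p` is a Euclidean projection of `v` onto `K`, i.e. a point of `K` nearest to `v`. -/
def IsProj {n : ℕ} (K : Set (Vec n)) (v p : Vec n) : Prop :=
  p ∈ K ∧ ∀ q ∈ K, ‖v - p‖ ≤ ‖v - q‖

/-- `z` is a run, started at `0`, of projected gradient descent
`z_{τ+1} = P_K (z_τ + μ A* (y - A z_τ))`. -/
def IsPGD {m n : ℕ} (A : Matrix (Fin m) (Fin n) ℝ) (y : Vec m) (μ : ℝ)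
    (K : Set (Vec n)) (z : ℕ → Vec n) : Prop :=
  z 0 = 0 ∧ ∀ τ : ℕ,
    IsProj K (z τ + μ • Matrix.toEuclideanLin A.transpose (y - Matrix.toEuclideanLin A (z τ)))
      (z (τ + 1))

/-- A Gaussian map: a random matrix with independent `N(0,1)` entries. -/
def IsGaussianMap {Ω : Type*} [MeasurableSpace Ω] (P : Measure Ω) {m n : ℕ}
    (A : Ω → Matrix (Fin m) (Fin n) ℝ) : Prop :=
  (∀ i j, HasLaw (fun ω => A ω i j) (gaussianReal 0 1) P) ∧
    iIndepFun (fun (ij : Fin m × Fin n) (ω : Ω) => A ω ij.1 ij.2) P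

/-- The rate `ρ = √8 κ √(m₀ / m)`. -/
def rate (κ m₀ : ℝ) (m : ℕ) : ℝ :=
  Real.sqrt 8 * κ * Real.sqrt (m₀ / m)

end PGD

end

noncomputable section

namespace PGD

/-! Since `y = A x`, the error before projection is `(I - μ A*A)(z_τ - x)`. The deterministic half
of the argument needs only one estimate, `|⟨u, (I - μ A*A) v⟩| ≤ a₀ ‖u‖ ‖v‖` with `a₀ = √8 φ(m₀) /
φ(m)`, for `u` in the tangent cone `C` and `v` in `C` or `v = -x`. The vector `-x` is the initial
error and need not lie in `C`. A nearest point costs a factor `κ` (`IsProj.norm_sub_le`), and `κ a₀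
≤ ρ` because `φ(t)² / t` is nondecreasing (`rate_bounds`). A linear recurrence then gives part (1).
For part (2) the same recurrence is run around `c x` with `c = R / f x`: homogeneity puts `c x` on
the boundary level and keeps the tangent cone unchanged, so one event serves all `R`. This
invariance of the cone is also part (3).

By polarization (`abs_residualForm_le`) the estimate follows from `|‖A w‖ - φ(m) ‖w‖| ≤ 2 (ω + η)`
for `w = u ± v` with `u`, `v` in the unit ball, and `φ(m₀) = ω + η`.

This near isometry is a Gordon-type bound. The process `A w` is compared with `(‖w‖ h, ⟨g, w⟩)`,
where `h` and `g` are independent standard Gaussian vectors. Thus the mean of `max_w ±(‖A w‖ - φ(m)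
‖w‖)` is at most `E sup ⟨g, w⟩ + 2 E|‖h‖ - φ(m)|`, and the last expectation is at most `1` because
`E‖h‖ = φ(m)` and `Var ‖h‖ = m - φ(m)² ≤ 1`. Fluctuations are controlled by Gaussian concentration
with Lipschitz constant `2`. Bounded additive losses are absorbed by `η` when `η ≥ 3`; for smaller
`η` the probability bound is vacuous.

Comparison and concentration both come from one interpolation formula: rotating from one Gaussian
vector to another differentiates `E Φ` into a difference of Laplacians. To have two derivatives,
maxima over finite families are replaced by soft maxima and norms by `√(c + ‖·‖²)`; passage to the
whole cone uses a countable dense subset. -/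

/-- The standard Gaussian measure on `κ → ℝ`. -/
abbrev gaussPi (κ : Type*) [Fintype κ] : Measure (κ → ℝ) :=
  Measure.pi (fun _ => gaussianReal 0 1)

/-! ### Gaussian integration by parts -/

lemma integrable_gaussianReal_iff {h : ℝ → ℝ} :
    Integrable h (gaussianReal 0 1) ↔ Integrable (fun s => h s * gaussianPDFReal 0 1 s) := by
  rw [gaussianReal_of_var_ne_zero 0 one_ne_zero, gaussianPDF_def,
    integrable_withDensity_iff (by fun_prop) (by simp)]
  simp [gaussianPDFReal_nonneg]

lemma hasDerivAt_gaussianPDFReal (s : ℝ) :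
    HasDerivAt (gaussianPDFReal 0 1) (-(s * gaussianPDFReal 0 1 s)) s := by
  simp only [gaussianPDFReal_def, NNReal.coe_one, mul_one, sub_zero]
  have h : HasDerivAt (fun x : ℝ => -x ^ 2 / 2) (-s) s := by
    refine (((hasDerivAt_pow 2 s).fun_neg).div_const 2).congr_deriv ?_
    norm_num
    ring
  refine ((h.exp).const_mul ((√(2 * Real.pi))⁻¹)).congr_deriv ?_
  ring

/-- Stein's identity: the density satisfies `p' = -s p`, so this is ordinary integration by parts on
the line. -/
lemma gaussianReal_integration_by_parts {h h' : ℝ → ℝ} (hd : ∀ s, HasDerivAt h (h' s) s)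
    (i0 : Integrable h (gaussianReal 0 1)) (i1 : Integrable h' (gaussianReal 0 1))
    (i2 : Integrable (fun s => s * h s) (gaussianReal 0 1)) :
    ∫ s, s * h s ∂(gaussianReal 0 1) = ∫ s, h' s ∂(gaussianReal 0 1) := by
  rw [integrable_gaussianReal_iff] at i0 i1 i2
  rw [integral_gaussianReal_eq_integral_smul one_ne_zero,
    integral_gaussianReal_eq_integral_smul one_ne_zero]
  have := integral_mul_deriv_eq_deriv_mul_of_integrable (u := h) (u' := h')
    (v := gaussianPDFReal 0 1) (v' := fun s => -(s * gaussianPDFReal 0 1 s))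
    (fun s _ => hd s) (fun s _ => hasDerivAt_gaussianPDFReal s) ?_ i1 i0
  · have e1 : ∀ s, h s * -(s * gaussianPDFReal 0 1 s)
        = -(gaussianPDFReal 0 1 s • (s * h s)) := fun s => by simp; ring
    have e2 : ∀ s, h' s * gaussianPDFReal 0 1 s = gaussianPDFReal 0 1 s • h' s :=
      fun s => by simp; ring
    simp only [e1, e2, integral_neg] at this
    linarith
  · refine i2.neg.congr (Filter.Eventually.of_forall fun s => ?_)
    simp; ring

lemma measurable_update_pair {κ : Type*} [DecidableEq κ] (k : κ) :
    Measurable fun p : (κ → ℝ) × ℝ => Function.update p.1 k p.2 := by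
  refine measurable_pi_lambda _ fun j => ?_
  by_cases h : j = k
  · subst h; simpa using measurable_snd
  · simp only [Function.update_of_ne h]; fun_prop

section Pi

variable {κ : Type*} [Fintype κ]

/-- Resampling one coordinate preserves the product measure. This reduces integration by parts in
coordinate `k` to dimension one without splitting the index type. -/
lemma map_update_gaussPi [DecidableEq κ] (k : κ) :
    ((gaussPi κ).prod (gaussianReal 0 1)).map (fun p => Function.update p.1 k p.2)
      = gaussPi κ := by
  have hmeas := measurable_update_pair (κ := κ) k
  symm
  refine Measure.pi_eq fun s hs => ?_
  rw [Measure.map_apply hmeas (MeasurableSet.univ_pi hs)]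
  have : (fun p : (κ → ℝ) × ℝ => Function.update p.1 k p.2) ⁻¹' (univ.pi s)
      = (univ.pi (Function.update s k univ)) ×ˢ (s k) := by
    ext ⟨x, t⟩
    simp only [mem_preimage, mem_pi, mem_univ, forall_const, mem_prod]
    constructor
    · intro h
      refine ⟨fun j => ?_, by simpa using h k⟩
      by_cases hj : j = k
      · subst hj; simp
      · simpa [Function.update_of_ne hj] using h j
    · rintro ⟨h, ht⟩ j
      by_cases hj : j = k
      · subst hj; simpa using ht
      · simpa [Function.update_of_ne hj] using h j
  rw [this, Measure.prod_prod, Measure.pi_pi, ← Finset.mul_prod_erase _ _ (Finset.mem_univ k),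
    ← Finset.mul_prod_erase (a := k) Finset.univ (fun i => gaussianReal 0 1 (s i))
      (Finset.mem_univ k)]
  simp only [Function.update_self, measure_univ, one_mul]
  rw [mul_comm]
  congr 1
  refine Finset.prod_congr rfl fun j hj => ?_
  rw [Function.update_of_ne (Finset.ne_of_mem_erase hj)]

lemma integrable_update [DecidableEq κ] (k : κ) {H : (κ → ℝ) → ℝ}
    (hH : Integrable H (gaussPi κ)) :
    Integrable (fun p : (κ → ℝ) × ℝ => H (Function.update p.1 k p.2))
      ((gaussPi κ).prod (gaussianReal 0 1)) := by
  rw [← map_update_gaussPi k] at hH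
  exact (integrable_map_measure hH.1 (measurable_update_pair k).aemeasurable).1 hH

lemma integral_update [DecidableEq κ] (k : κ) {H : (κ → ℝ) → ℝ}
    (hH : Integrable H (gaussPi κ)) :
    ∫ x, ∫ s, H (Function.update x k s) ∂(gaussianReal 0 1) ∂(gaussPi κ)
      = ∫ x, H x ∂(gaussPi κ) := by
  rw [← integral_prod (fun p : (κ → ℝ) × ℝ => H (Function.update p.1 k p.2))
    (integrable_update k hH)]
  conv_rhs => rw [← map_update_gaussPi k]
  rw [integral_map (measurable_update_pair k).aemeasurable]
  rw [map_update_gaussPi k]; exact hH.1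

lemma gaussPi_integration_by_parts [DecidableEq κ] (k : κ) {H H' : (κ → ℝ) → ℝ}
    (hd : ∀ x, HasDerivAt (fun s => H (Function.update x k s)) (H' x) (x k))
    (i0 : Integrable H (gaussPi κ)) (i1 : Integrable H' (gaussPi κ))
    (i2 : Integrable (fun x => x k * H x) (gaussPi κ)) :
    ∫ x, x k * H x ∂(gaussPi κ) = ∫ x, H' x ∂(gaussPi κ) := by
  rw [← integral_update k i2, ← integral_update k i1]
  refine integral_congr_ae ?_
  filter_upwards [(integrable_update k i0).prod_right_ae, (integrable_update k i1).prod_right_ae,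
    (integrable_update k i2).prod_right_ae] with x h0 h1 h2
  simp only [Function.update_self] at h2 ⊢
  refine gaussianReal_integration_by_parts (fun s => ?_) h0 h1 h2
  simpa using hd (Function.update x k s)

lemma integrable_exp_mul_abs_gaussianReal (C : ℝ) :
    Integrable (fun s : ℝ => Real.exp (C * |s|)) (gaussianReal 0 1) := by
  refine ((integrable_exp_mul_gaussianReal C).add (integrable_exp_mul_gaussianReal (-C))).mono'
    (by fun_prop) (Filter.Eventually.of_forall fun s => ?_)
  rw [Real.norm_eq_abs, Real.abs_exp, Pi.add_apply]
  rcases abs_cases s with ⟨h, _⟩ | ⟨h, _⟩ <;> rw [h]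
  · exact le_add_of_nonneg_right (Real.exp_pos _).le
  · rw [mul_neg, ← neg_mul]; exact le_add_of_nonneg_left (Real.exp_pos _).le

lemma integrable_exp_sum_abs (C : ℝ) :
    Integrable (fun x : κ → ℝ => Real.exp (C * ∑ k, |x k|)) (gaussPi κ) := by
  simp_rw [Finset.mul_sum, Real.exp_sum]
  exact Integrable.fintype_prod (f := fun _ s => Real.exp (C * |s|))
    fun _ => integrable_exp_mul_abs_gaussianReal C

lemma integrable_of_exp_growth {H : (κ → ℝ) → ℝ} (hH : AEStronglyMeasurable H (gaussPi κ))
    {C D : ℝ} (h : ∀ x, |H x| ≤ C * Real.exp (D * ∑ k, |x k|)) : Integrable H (gaussPi κ) :=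
  ((integrable_exp_sum_abs D).const_mul C).mono' hH (Filter.Eventually.of_forall h)

end Pi

/-! ### Differentiating Gaussian expectations -/

/-- `d₁ z p` and `d₂ z p` are the first and second derivatives of `Φ` at `z` along `p`, and
all of them grow at most exponentially. -/
structure SecondOrder {V : Type*} [NormedAddCommGroup V] [NormedSpace ℝ V]
    (Φ : V → ℝ) (d₁ d₂ : V → V → ℝ) : Prop where
  contDiff : ContDiff ℝ 2 Φ
  hasDerivAt : ∀ z p, HasDerivAt (fun s : ℝ => Φ (z + s • p)) (d₁ z p) 0
  hasDerivAt' : ∀ z p, HasDerivAt (fun s : ℝ => d₁ (z + s • p) p) (d₂ z p) 0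
  growth : ∃ C D, 0 ≤ D ∧ ∀ z p, |Φ z| ≤ C * Real.exp (D * ‖z‖) ∧
    |d₁ z p| ≤ C * ‖p‖ * Real.exp (D * ‖z‖) ∧ |d₂ z p| ≤ C * ‖p‖ ^ 2 * Real.exp (D * ‖z‖)

namespace SecondOrder

variable {V : Type*} [NormedAddCommGroup V] [NormedSpace ℝ V] {Φ : V → ℝ} {d₁ d₂ : V → V → ℝ}

lemma hasFDerivAt (h : SecondOrder Φ d₁ d₂) (z : V) : HasFDerivAt Φ (fderiv ℝ Φ z) z :=
  (h.contDiff.differentiable (by norm_num) z).hasFDerivAt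

lemma fderiv_apply (h : SecondOrder Φ d₁ d₂) (z p : V) : fderiv ℝ Φ z p = d₁ z p :=
  ((h.hasFDerivAt z).hasLineDerivAt p).unique (h.hasDerivAt z p)

lemma contDiff_d₁ (h : SecondOrder Φ d₁ d₂) (p : V) : ContDiff ℝ 1 (fun z => d₁ z p) := by
  simp_rw [← h.fderiv_apply]
  exact (h.contDiff.fderiv_right (m := 1) (by norm_num)).clm_apply contDiff_const

lemma fderiv_d₁_apply (h : SecondOrder Φ d₁ d₂) (z p : V) :
    fderiv ℝ (fun z => d₁ z p) z p = d₂ z p :=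
  ((((h.contDiff_d₁ p).differentiable (by norm_num) z).hasFDerivAt).hasLineDerivAt p).unique
    (h.hasDerivAt' z p)

lemma continuous_d₂ (h : SecondOrder Φ d₁ d₂) (p : V) : Continuous (fun z => d₂ z p) := by
  simp_rw [← h.fderiv_d₁_apply]
  exact ((h.contDiff_d₁ p).continuous_fderiv (by norm_num)).clm_apply continuous_const

lemma d₁_smul (h : SecondOrder Φ d₁ d₂) (z p : V) (c : ℝ) : d₁ z (c • p) = c * d₁ z p := by
  rw [← h.fderiv_apply, ← h.fderiv_apply, map_smul, smul_eq_mul]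

lemma d₁_sum (h : SecondOrder Φ d₁ d₂) {κ : Type*} [Fintype κ] (z : V) (p : κ → V) :
    d₁ z (∑ k, p k) = ∑ k, d₁ z (p k) := by
  simp_rw [← h.fderiv_apply, map_sum]

variable {κ : Type*} [Fintype κ]

lemma norm_sum_smul_le (p : κ → V) : ∃ M : ℝ, 0 ≤ M ∧ ∀ (c : κ → ℝ), (∀ k, |c k| ≤ 1) →
    ∀ x : κ → ℝ, ‖∑ k, (c k * x k) • p k‖ ≤ M * ∑ k, |x k| := by
  refine ⟨∑ k, ‖p k‖, by positivity, fun c hc x => ?_⟩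
  rw [Finset.mul_sum]
  refine (norm_sum_le _ _).trans (Finset.sum_le_sum fun k _ => ?_)
  rw [norm_smul, Real.norm_eq_abs, abs_mul]
  have h1 : ‖p k‖ ≤ ∑ k, ‖p k‖ :=
    Finset.single_le_sum (f := fun k => ‖p k‖) (fun _ _ => norm_nonneg _) (Finset.mem_univ k)
  calc |c k| * |x k| * ‖p k‖ ≤ 1 * |x k| * (∑ k, ‖p k‖) := by
        have := hc k
        gcongr
    _ = _ := by ring

lemma _root_.PGD.integrable_comp_sum_smul {H : V → ℝ} (hH : Continuous H) {C D : ℝ} (hD : 0 ≤ D)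
    (hb : ∀ z, |H z| ≤ C * Real.exp (D * ‖z‖)) (p : κ → V) {c : κ → ℝ} (hc : ∀ k, |c k| ≤ 1) :
    Integrable (fun x => H (∑ k, (c k * x k) • p k)) (gaussPi κ) := by
  obtain ⟨M, hM0, hM⟩ := norm_sum_smul_le p
  have hC0 : 0 ≤ C := nonneg_of_mul_nonneg_left ((abs_nonneg _).trans (hb 0)) (Real.exp_pos _)
  refine integrable_of_exp_growth (C := C) (D := D * M)
    (hH.comp (by fun_prop)).aestronglyMeasurable fun x => (hb _).trans ?_
  refine mul_le_mul_of_nonneg_left ?_ hC0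
  rw [Real.exp_le_exp, mul_assoc]
  exact mul_le_mul_of_nonneg_left (hM _ hc x) hD

lemma integrable (h : SecondOrder Φ d₁ d₂) (p : κ → V) {c : κ → ℝ} (hc : ∀ k, |c k| ≤ 1) :
    Integrable (fun x => Φ (∑ k, (c k * x k) • p k)) (gaussPi κ) := by
  obtain ⟨C, D, hD0, hC⟩ := h.growth
  exact integrable_comp_sum_smul h.contDiff.continuous hD0 (fun z => (hC z 0).1) p hc

lemma integrable_d₂ (h : SecondOrder Φ d₁ d₂) (p : κ → V) {c : κ → ℝ} (hc : ∀ k, |c k| ≤ 1)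
    (v : V) : Integrable (fun x => d₂ (∑ k, (c k * x k) • p k) v) (gaussPi κ) := by
  obtain ⟨C, D, hD0, hC⟩ := h.growth
  exact integrable_comp_sum_smul (h.continuous_d₂ v) hD0 (fun z => (hC z v).2.2) p hc

/-- Derivative of a Gaussian expectation along a path of linear combinations. -/
theorem hasDerivAt_integral (h : SecondOrder Φ d₁ d₂) (p : κ → V) {c c' : κ → ℝ → ℝ}
    (hc : ∀ k θ, HasDerivAt (c k) (c' k θ) θ) (hb : ∀ k θ, |c k θ| ≤ 1)
    (hb' : ∀ k θ, |c' k θ| ≤ 1) (θ : ℝ) :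
    HasDerivAt (fun θ => ∫ x, Φ (∑ k, (c k θ * x k) • p k) ∂(gaussPi κ))
      (∑ k, c' k θ * c k θ * ∫ x, d₂ (∑ k, (c k θ * x k) • p k) (p k) ∂(gaussPi κ)) θ := by
  classical
  obtain ⟨C, D, hD0, hC⟩ := h.growth
  obtain ⟨M, hM0, hM⟩ := norm_sum_smul_le p
  have hC0 : 0 ≤ C := by
    have := (abs_nonneg _).trans (hC 0 0).1
    exact nonneg_of_mul_nonneg_left this (Real.exp_pos _)
  set Z : ℝ → (κ → ℝ) → V := fun θ x => ∑ k, (c k θ * x k) • p k with hZ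
  have hZc : ∀ θ, Continuous (Z θ) := fun θ => by
    simp only [hZ]; fun_prop
  have hexp : ∀ θ x, Real.exp (D * ‖Z θ x‖) ≤ Real.exp (D * M * ∑ k, |x k|) := fun θ x => by
    rw [Real.exp_le_exp, mul_assoc]
    exact mul_le_mul_of_nonneg_left (hM _ (fun k => hb k θ) x) hD0
  have hxk : ∀ (x : κ → ℝ) k, |x k| ≤ Real.exp (∑ k, |x k|) := fun x k =>
    (Finset.single_le_sum (f := fun k => |x k|) (fun _ _ => abs_nonneg _)
      (Finset.mem_univ k)).trans ((by linarith [Real.add_one_le_exp (∑ k, |x k|)]))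
  have i0 : ∀ θ, Integrable (fun x => Φ (Z θ x)) (gaussPi κ) := fun θ =>
    h.integrable p (fun k => hb k θ)
  have c1 : ∀ θ k, Continuous fun x => d₁ (Z θ x) (p k) := fun θ k =>
    (h.contDiff_d₁ (p k)).continuous.comp (hZc θ)
  have i1 : ∀ θ k, Integrable (fun x => d₁ (Z θ x) (p k)) (gaussPi κ) := fun θ k =>
    integrable_of_exp_growth (C := C * ‖p k‖) (D := D * M) (c1 θ k).aestronglyMeasurable
      fun x => ((hC _ _).2.1).trans (mul_le_mul_of_nonneg_left (hexp θ x) (by positivity))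
  have b1 : ∀ θ k x, |x k * d₁ (Z θ x) (p k)| ≤
      C * ‖p k‖ * Real.exp ((D * M + 1) * ∑ k, |x k|) := fun θ k x => by
    rw [abs_mul, add_mul, Real.exp_add, one_mul]
    calc |x k| * |d₁ (Z θ x) (p k)| ≤ Real.exp (∑ k, |x k|) *
          (C * ‖p k‖ * Real.exp (D * M * ∑ k, |x k|)) :=
          mul_le_mul (hxk x k) (((hC _ _).2.1).trans
            (mul_le_mul_of_nonneg_left (hexp θ x) (by positivity))) (abs_nonneg _)
            (Real.exp_pos _).le
      _ = _ := by ring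
  have i1' : ∀ θ k, Integrable (fun x => x k * d₁ (Z θ x) (p k)) (gaussPi κ) := fun θ k =>
    integrable_of_exp_growth (((continuous_apply k).mul (c1 θ k)).aestronglyMeasurable)
      (b1 θ k)
  have i2 : ∀ θ k, Integrable (fun x => c k θ * d₂ (Z θ x) (p k)) (gaussPi κ) := fun θ k =>
    (h.integrable_d₂ p (fun k => hb k θ) (p k)).const_mul _
  have hupd : ∀ θ k x (s : ℝ), Z θ (Function.update x k s)
      = Z θ x + (c k θ * (s - x k)) • p k := fun θ k x s => by
    simp only [hZ]
    rw [← Finset.add_sum_erase _ _ (Finset.mem_univ k),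
      ← Finset.add_sum_erase (a := k) Finset.univ (fun i => (c i θ * x i) • p i)
        (Finset.mem_univ k)]
    rw [Finset.sum_congr rfl (fun j hj => by
      rw [Function.update_of_ne (Finset.ne_of_mem_erase hj)])]
    simp only [Function.update_self, mul_sub, sub_smul]
    abel
  -- The factor `x k` produced by the chain rule is traded for a second derivative; this is where
  -- first-order terms become Laplacians.
  have ibp : ∀ θ k, ∫ x, x k * d₁ (Z θ x) (p k) ∂(gaussPi κ)
      = ∫ x, c k θ * d₂ (Z θ x) (p k) ∂(gaussPi κ) := fun θ k => by
    refine gaussPi_integration_by_parts k (H := fun x => d₁ (Z θ x) (p k)) (fun x => ?_)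
      (i1 θ k) (i2 θ k) (i1' θ k)
    simp only [hupd]
    have h1 : HasDerivAt (fun s : ℝ => c k θ * (s - x k)) (c k θ) (x k) := by
      simpa using ((hasDerivAt_id (x k)).sub_const (x k)).const_mul (c k θ)
    have h2 : HasDerivAt (fun s : ℝ => d₁ (Z θ x + s • p k) (p k)) (d₂ (Z θ x) (p k))
        (c k θ * (x k - x k)) := by simpa using h.hasDerivAt' (Z θ x) (p k)
    have := h2.comp (x k) h1
    rwa [mul_comm] at this
  have hderiv : ∀ x θ, HasDerivAt (fun θ => Φ (Z θ x))
      (∑ k, c' k θ * (x k * d₁ (Z θ x) (p k))) θ := fun x θ => by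
    have hz : HasDerivAt (fun θ => Z θ x) (∑ k, (c' k θ * x k) • p k) θ := by
      simp only [hZ]
      exact HasDerivAt.fun_sum fun k _ => ((hc k θ).mul_const (x k)).smul_const (p k)
    refine ((h.hasFDerivAt (Z θ x)).comp_hasDerivAt θ hz).congr_deriv ?_
    rw [h.fderiv_apply, h.d₁_sum]
    refine Finset.sum_congr rfl fun k _ => ?_
    rw [h.d₁_smul]; ring
  have key := hasDerivAt_integral_of_dominated_loc_of_deriv_le (μ := gaussPi κ)
    (F := fun θ x => Φ (Z θ x)) (F' := fun θ x => ∑ k, c' k θ * (x k * d₁ (Z θ x) (p k)))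
    (bound := fun x => ∑ k, C * ‖p k‖ * Real.exp ((D * M + 1) * ∑ k, |x k|)) (x₀ := θ)
    (s := univ) Filter.univ_mem
    (Filter.Eventually.of_forall fun θ => (i0 θ).1) (i0 θ)
    ((integrable_finsetSum _ fun k _ => (i1' θ k).const_mul _).1)
    (Filter.Eventually.of_forall fun x θ _ => ?_)
    (integrable_finsetSum _ fun k _ => (integrable_exp_sum_abs _).const_mul _)
    (Filter.Eventually.of_forall fun x θ _ => hderiv x θ)
  · refine key.2.congr_deriv ?_
    rw [integral_finsetSum _ fun k _ => (i1' θ k).const_mul _]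
    refine Finset.sum_congr rfl fun k _ => ?_
    rw [integral_const_mul, ibp, integral_const_mul]
    ring
  · rw [Real.norm_eq_abs]
    refine (Finset.abs_sum_le_sum_abs _ _).trans (Finset.sum_le_sum fun k _ => ?_)
    rw [abs_mul]
    calc |c' k θ| * |x k * d₁ (Z θ x) (p k)| ≤ 1 * |x k * d₁ (Z θ x) (p k)| := by
          have := hb' k θ
          gcongr
      _ ≤ _ := by rw [one_mul]; exact b1 θ k x

end SecondOrder

/-! ### Rotation between two Gaussian vectors -/

lemma abs_weight_le {κ₁ κ₂ : Type*} (θ : ℝ) (k : κ₁ ⊕ κ₂) :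
    |Sum.elim (fun _ => Real.cos θ) (fun _ => Real.sin θ) k| ≤ 1 := by
  rcases k with k | k
  · simpa using Real.abs_cos_le_one θ
  · simpa using Real.abs_sin_le_one θ

section Interpolation

variable {κ₁ κ₂ : Type*} [Fintype κ₁] [Fintype κ₂]

lemma measurePreserving_gaussPi_sum :
    MeasurePreserving (fun x : κ₁ ⊕ κ₂ → ℝ => ((fun k => x (Sum.inl k)), fun k => x (Sum.inr k)))
      (gaussPi (κ₁ ⊕ κ₂)) ((gaussPi κ₁).prod (gaussPi κ₂)) :=
  measurePreserving_sumPiEquivProdPi (X := fun _ : κ₁ ⊕ κ₂ => ℝ) (fun _ => gaussianReal 0 1)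

lemma integral_gaussPi_sum {f : (κ₁ → ℝ) × (κ₂ → ℝ) → ℝ} (hf : Continuous f) :
    ∫ x, f ((fun k => x (Sum.inl k)), fun k => x (Sum.inr k)) ∂(gaussPi (κ₁ ⊕ κ₂))
      = ∫ z, f z ∂((gaussPi κ₁).prod (gaussPi κ₂)) := by
  rw [← measurePreserving_gaussPi_sum.map_eq,
    integral_map measurePreserving_gaussPi_sum.aemeasurable hf.aestronglyMeasurable]

lemma integral_gaussPi_inl {f : (κ₁ → ℝ) → ℝ} (hf : Continuous f) :
    ∫ x, f (fun k => x (Sum.inl k)) ∂(gaussPi (κ₁ ⊕ κ₂)) = ∫ x, f x ∂(gaussPi κ₁) := by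
  rw [integral_gaussPi_sum (f := fun z => f z.1) (by fun_prop),
    integral_fun_fst (μ := gaussPi κ₁) (ν := gaussPi κ₂) f]
  simp

lemma integral_gaussPi_inr {f : (κ₂ → ℝ) → ℝ} (hf : Continuous f) :
    ∫ x, f (fun k => x (Sum.inr k)) ∂(gaussPi (κ₁ ⊕ κ₂)) = ∫ x, f x ∂(gaussPi κ₂) := by
  rw [integral_gaussPi_sum (f := fun z => f z.2) (by fun_prop),
    integral_fun_snd (μ := gaussPi κ₁) (ν := gaussPi κ₂) f]
  simp

variable {V : Type*} [NormedAddCommGroup V] [NormedSpace ℝ V] {Φ : V → ℝ} {d₁ d₂ : V → V → ℝ}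

/-- The rotation path between `∑ xₖ pₖ` and `∑ yₖ qₖ`. -/
def rotationPath (p : κ₁ → V) (q : κ₂ → V) (θ : ℝ) (x : κ₁ ⊕ κ₂ → ℝ) : V :=
  ∑ k, (Sum.elim (fun _ => Real.cos θ) (fun _ => Real.sin θ) k * x k) • Sum.elim p q k

lemma rotationPath_eq (p : κ₁ → V) (q : κ₂ → V) (θ : ℝ) (x : κ₁ ⊕ κ₂ → ℝ) :
    rotationPath p q θ x = (∑ k, (Real.cos θ * x (Sum.inl k)) • p k)
      + ∑ k, (Real.sin θ * x (Sum.inr k)) • q k := by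
  simp [rotationPath]

namespace SecondOrder

/-- The weights `cos θ` and `sin θ` have `c' c = ∓ sin θ cos θ`, so the two blocks enter with
opposite signs and only the difference of the two Laplacians remains. -/
lemma hasDerivAt_rotation (h : SecondOrder Φ d₁ d₂) (p : κ₁ → V) (q : κ₂ → V) (θ : ℝ) :
    HasDerivAt (fun θ => ∫ x, Φ (rotationPath p q θ x) ∂(gaussPi (κ₁ ⊕ κ₂)))
      (Real.sin θ * Real.cos θ * ∫ x, (∑ k, d₂ (rotationPath p q θ x) (q k)
        - ∑ k, d₂ (rotationPath p q θ x) (p k)) ∂(gaussPi (κ₁ ⊕ κ₂))) θ := by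
  have := h.hasDerivAt_integral (κ := κ₁ ⊕ κ₂) (Sum.elim p q)
    (c := fun k θ => Sum.elim (fun _ => Real.cos θ) (fun _ => Real.sin θ) k)
    (c' := fun k θ => Sum.elim (fun _ => -Real.sin θ) (fun _ => Real.cos θ) k)
    (fun k θ => by
      rcases k with k | k
      · simpa using Real.hasDerivAt_cos θ
      · simpa using Real.hasDerivAt_sin θ)
    (fun k θ => abs_weight_le θ k)
    (fun k θ => by
      rcases k with k | k
      · simpa using Real.abs_sin_le_one θ
      · simpa using Real.abs_cos_le_one θ) θ
  refine this.congr_deriv ?_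
  have hi : ∀ v, Integrable (fun x => d₂ (rotationPath p q θ x) v) (gaussPi (κ₁ ⊕ κ₂)) :=
    fun v => h.integrable_d₂ (Sum.elim p q) (abs_weight_le θ) v
  rw [integral_sub (integrable_finsetSum _ fun k _ => hi _)
    (integrable_finsetSum _ fun k _ => hi _), integral_finsetSum _ fun k _ => hi _,
    integral_finsetSum _ fun k _ => hi _, Fintype.sum_sum_type]
  simp only [Sum.elim_inl, Sum.elim_inr]
  change ∑ k, -Real.sin θ * Real.cos θ * (∫ x, d₂ (rotationPath p q θ x) (p k)
    ∂(gaussPi (κ₁ ⊕ κ₂))) + ∑ k, Real.cos θ * Real.sin θ *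
      (∫ x, d₂ (rotationPath p q θ x) (q k) ∂(gaussPi (κ₁ ⊕ κ₂))) = _
  rw [← Finset.mul_sum, ← Finset.mul_sum]
  ring

lemma integral_rotation_zero (h : SecondOrder Φ d₁ d₂) (p : κ₁ → V) (q : κ₂ → V) :
    ∫ x, Φ (rotationPath p q 0 x) ∂(gaussPi (κ₁ ⊕ κ₂))
      = ∫ x, Φ (∑ k, x k • p k) ∂(gaussPi κ₁) := by
  have hΦ := h.contDiff.continuous
  rw [← integral_gaussPi_inl (κ₂ := κ₂) (f := fun x => Φ (∑ k, x k • p k)) (by fun_prop)]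
  simp [rotationPath_eq]

lemma integral_rotation_pi_div_two (h : SecondOrder Φ d₁ d₂) (p : κ₁ → V) (q : κ₂ → V) :
    ∫ x, Φ (rotationPath p q (Real.pi / 2) x) ∂(gaussPi (κ₁ ⊕ κ₂))
      = ∫ x, Φ (∑ k, x k • q k) ∂(gaussPi κ₂) := by
  have hΦ := h.contDiff.continuous
  rw [← integral_gaussPi_inr (κ₁ := κ₁) (f := fun x => Φ (∑ k, x k • q k)) (by fun_prop)]
  simp [rotationPath_eq]

/-- Equal Laplacians: the expectation is constant along the rotation path. -/
theorem integral_rotation_eq (h : SecondOrder Φ d₁ d₂) (p : κ₁ → V) (q : κ₂ → V)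
    (hpq : ∀ z, ∑ k, d₂ z (q k) = ∑ k, d₂ z (p k)) (θ : ℝ) :
    ∫ x, Φ (rotationPath p q θ x) ∂(gaussPi (κ₁ ⊕ κ₂))
      = ∫ x, Φ (∑ k, x k • q k) ∂(gaussPi κ₂) := by
  rw [← h.integral_rotation_pi_div_two p q]
  refine is_const_of_deriv_eq_zero
    (f := fun θ => ∫ x, Φ (rotationPath p q θ x) ∂(gaussPi (κ₁ ⊕ κ₂)))
    (fun θ => (h.hasDerivAt_rotation p q θ).differentiableAt) (fun θ => ?_) _ _
  rw [(h.hasDerivAt_rotation p q θ).deriv]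
  simp [hpq]

/-- Gaussian comparison by interpolation, with an error term. -/
theorem integral_le_add (h : SecondOrder Φ d₁ d₂) (p : κ₁ → V) (q : κ₂ → V) {B : ℝ}
    (hB : ∀ θ, ∫ x, (∑ k, d₂ (rotationPath p q θ x) (q k)
        - ∑ k, d₂ (rotationPath p q θ x) (p k)) ∂(gaussPi (κ₁ ⊕ κ₂)) ≤ 2 * B) :
    ∫ x, Φ (∑ k, x k • q k) ∂(gaussPi κ₂) ≤ ∫ x, Φ (∑ k, x k • p k) ∂(gaussPi κ₁) + B := by
  rw [← h.integral_rotation_pi_div_two p q, ← h.integral_rotation_zero p q]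
  -- The correction `B sin² θ` has derivative `2 B sin θ cos θ`, matching the allowed error, and
  -- increases by exactly `B` over the path.
  have hd : ∀ θ, HasDerivAt (fun θ => (∫ x, Φ (rotationPath p q θ x) ∂(gaussPi (κ₁ ⊕ κ₂)))
      - B * Real.sin θ ^ 2) (Real.sin θ * Real.cos θ * (∫ x, (∑ k, d₂ (rotationPath p q θ x) (q k)
        - ∑ k, d₂ (rotationPath p q θ x) (p k)) ∂(gaussPi (κ₁ ⊕ κ₂)))
        - B * (2 * Real.sin θ * Real.cos θ)) θ := fun θ => by
    refine (h.hasDerivAt_rotation p q θ).sub ?_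
    refine (((Real.hasDerivAt_sin θ).fun_pow 2).const_mul B).congr_deriv ?_
    norm_num
  have hanti := antitoneOn_of_deriv_nonpos (convex_Icc 0 (Real.pi / 2))
    (f := fun θ => (∫ x, Φ (rotationPath p q θ x) ∂(gaussPi (κ₁ ⊕ κ₂))) - B * Real.sin θ ^ 2)
    (fun θ _ => (hd θ).continuousAt.continuousWithinAt)
    (fun θ _ => (hd θ).differentiableAt.differentiableWithinAt) (fun θ hθ => by
      rw [interior_Icc] at hθ
      rw [(hd θ).deriv]
      have h1 := Real.sin_pos_of_pos_of_lt_pi hθ.1 (by linarith [hθ.2, Real.pi_pos])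
      have h2 := Real.cos_pos_of_mem_Ioo ⟨by linarith [hθ.1, Real.pi_pos], hθ.2⟩
      have := mul_le_mul_of_nonneg_left (hB θ) (mul_pos h1 h2).le
      linarith)
  have := hanti (left_mem_Icc.2 (by positivity)) (right_mem_Icc.2 (by positivity))
    (by positivity : (0:ℝ) ≤ Real.pi / 2)
  simp at this
  linarith

/-- Gaussian comparison by interpolation. -/
theorem integral_le (h : SecondOrder Φ d₁ d₂) (p : κ₁ → V) (q : κ₂ → V)
    (hpq : ∀ z, ∑ k, d₂ z (q k) ≤ ∑ k, d₂ z (p k)) :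
    ∫ x, Φ (∑ k, x k • q k) ∂(gaussPi κ₂) ≤ ∫ x, Φ (∑ k, x k • p k) ∂(gaussPi κ₁) := by
  have := h.integral_le_add p q (B := 0) (fun θ => by
    rw [mul_zero]
    exact integral_nonpos fun x => by simpa using hpq _)
  simpa using this

end SecondOrder

end Interpolation

/-! ### Functions with bounded derivatives and their exponential tilts -/

/-- A `C²` function whose first and second directional derivatives `d₁`, `d₂` are bounded. -/
structure BoundedSecondOrder {V : Type*} [NormedAddCommGroup V] [NormedSpace ℝ V]
    (F : V → ℝ) (d₁ d₂ : V → V → ℝ) : Prop where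
  contDiff : ContDiff ℝ 2 F
  hasDerivAt : ∀ z p, HasDerivAt (fun s : ℝ => F (z + s • p)) (d₁ z p) 0
  hasDerivAt' : ∀ z p, HasDerivAt (fun s : ℝ => d₁ (z + s • p) p) (d₂ z p) 0
  bound : ∃ C, 0 ≤ C ∧ ∀ z p, |d₁ z p| ≤ C * ‖p‖ ∧ |d₂ z p| ≤ C * ‖p‖ ^ 2

namespace BoundedSecondOrder

variable {V : Type*} [NormedAddCommGroup V] [NormedSpace ℝ V] {F : V → ℝ} {d₁ d₂ : V → V → ℝ}

lemma fderiv_apply (h : BoundedSecondOrder F d₁ d₂) (z p : V) : fderiv ℝ F z p = d₁ z p :=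
  (((h.contDiff.differentiable (by norm_num) z).hasFDerivAt).hasLineDerivAt p).unique
    (h.hasDerivAt z p)

lemma exists_linear_growth (h : BoundedSecondOrder F d₁ d₂) :
    ∃ C, 0 ≤ C ∧ (∀ z p, |d₁ z p| ≤ C * ‖p‖ ∧ |d₂ z p| ≤ C * ‖p‖ ^ 2) ∧
      ∀ z, |F z| ≤ |F 0| + C * ‖z‖ := by
  obtain ⟨C, hC0, hC⟩ := h.bound
  refine ⟨C, hC0, hC, fun z => ?_⟩
  have := convex_univ.norm_image_sub_le_of_norm_fderiv_le (𝕜 := ℝ) (f := F) (C := C)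
    (fun x _ => h.contDiff.differentiable (by norm_num) x)
    (fun x _ => ContinuousLinearMap.opNorm_le_bound _ hC0 fun p => by
      rw [h.fderiv_apply]; exact (hC x p).1) (mem_univ 0) (mem_univ z)
  rw [sub_zero, Real.norm_eq_abs] at this
  have h2 := abs_sub_abs_le_abs_sub (F z) (F 0)
  linarith

lemma secondOrder (h : BoundedSecondOrder F d₁ d₂) : SecondOrder F d₁ d₂ where
  contDiff := h.contDiff
  hasDerivAt := h.hasDerivAt
  hasDerivAt' := h.hasDerivAt'
  growth := by
    obtain ⟨C, hC0, hC, hF⟩ := h.exists_linear_growth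
    refine ⟨|F 0| + C, 1, zero_le_one, fun z p => ?_⟩
    have h1 : 1 ≤ Real.exp (1 * ‖z‖) := Real.one_le_exp (by positivity)
    have h2 : ‖z‖ ≤ Real.exp (1 * ‖z‖) := by linarith [Real.add_one_le_exp (1 * ‖z‖)]
    have h3 := abs_nonneg (F 0)
    refine ⟨(hF z).trans ?_, (hC z p).1.trans ?_, (hC z p).2.trans ?_⟩
    · rw [add_mul]
      gcongr
      exact le_mul_of_one_le_right h3 h1
    · calc C * ‖p‖ = C * ‖p‖ * 1 := by ring
        _ ≤ _ := by gcongr; linarith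
    · calc C * ‖p‖ ^ 2 = C * ‖p‖ ^ 2 * 1 := by ring
        _ ≤ _ := by gcongr; linarith

lemma d₁_zero (h : BoundedSecondOrder F d₁ d₂) (z : V) : d₁ z 0 = 0 := by
  rw [← h.fderiv_apply, map_zero]

lemma d₂_zero (h : BoundedSecondOrder F d₁ d₂) (z : V) : d₂ z 0 = 0 := by
  obtain ⟨C, -, hC⟩ := h.bound
  have := (hC z 0).2
  simpa using this

/-- Two choices of parameters matter for concentration: `α = 1, β = 0` gives `F(x) exp (l F(y))`,
whose expectation is interpolated, and `α = 0, β = 1` gives the bare exponential, which controls the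
error along the path. -/
lemma exp_tilt (h : BoundedSecondOrder F d₁ d₂) (α β l : ℝ) :
    SecondOrder (fun z : V × V => (α * F z.1 + β) * Real.exp (l * F z.2))
      (fun z p => (α * d₁ z.1 p.1 + (α * F z.1 + β) * (l * d₁ z.2 p.2)) * Real.exp (l * F z.2))
      (fun z p => (α * d₂ z.1 p.1 + 2 * (α * l * (d₁ z.1 p.1 * d₁ z.2 p.2))
        + (α * F z.1 + β) * (l * d₂ z.2 p.2 + (l * d₁ z.2 p.2) ^ 2)) * Real.exp (l * F z.2)) where
  contDiff := by
    have := h.contDiff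
    fun_prop
  hasDerivAt z p := by
    have hx := h.hasDerivAt z.1 p.1
    have hy := h.hasDerivAt z.2 p.2
    refine (((hx.const_mul α).add_const β).mul ((hy.const_mul l).exp)).congr_deriv ?_
    simp
    ring
  hasDerivAt' z p := by
    have hx := h.hasDerivAt z.1 p.1
    have hy := h.hasDerivAt z.2 p.2
    have hx' := h.hasDerivAt' z.1 p.1
    have hy' := h.hasDerivAt' z.2 p.2
    refine (((hx'.const_mul α).add
      (((hx.const_mul α).add_const β).mul (hy'.const_mul l))).mul
        ((hy.const_mul l).exp)).congr_deriv ?_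
    simp
    ring
  growth := by
    obtain ⟨C, hC0, hC, hF⟩ := h.exists_linear_growth
    set A := |α| * (|F 0| + C) + |β| with hA
    set E := Real.exp (|l| * |F 0|) with hE
    have hA0 : 0 ≤ A := by positivity
    refine ⟨(A + (|α| * C + A * (|l| * C)) + (|α| * C + 2 * (|α| * |l| * (C * C))
      + A * (|l| * C + (|l| * C) ^ 2))) * E, 1 + |l| * C, by positivity, fun z p => ?_⟩
    have h1 : 1 ≤ Real.exp ‖z‖ := Real.one_le_exp (by positivity)
    have h2 : ‖z‖ ≤ Real.exp ‖z‖ := by linarith [Real.add_one_le_exp ‖z‖]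
    have n1 : ‖z.1‖ ≤ ‖z‖ := norm_fst_le z
    have n2 : ‖z.2‖ ≤ ‖z‖ := norm_snd_le z
    have m1 : ‖p.1‖ ≤ ‖p‖ := norm_fst_le p
    have m2 : ‖p.2‖ ≤ ‖p‖ := norm_snd_le p
    have a0 : |α * F z.1 + β| ≤ A * Real.exp ‖z‖ := by
      calc |α * F z.1 + β| ≤ |α| * |F z.1| + |β| := (abs_add_le _ _).trans (by rw [abs_mul])
        _ ≤ |α| * (|F 0| * Real.exp ‖z‖ + C * Real.exp ‖z‖) + |β| * Real.exp ‖z‖ := by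
          have e1 : |F z.1| ≤ |F 0| * Real.exp ‖z‖ + C * Real.exp ‖z‖ :=
            (hF z.1).trans (add_le_add (le_mul_of_one_le_right (abs_nonneg _) h1)
              (mul_le_mul_of_nonneg_left (n1.trans h2) hC0))
          have e2 : |β| ≤ |β| * Real.exp ‖z‖ := le_mul_of_one_le_right (abs_nonneg _) h1
          gcongr
        _ = _ := by rw [hA]; ring
    have a1 : |d₁ z.1 p.1| ≤ C * ‖p‖ := (hC _ _).1.trans (by gcongr)
    have a1' : |d₁ z.2 p.2| ≤ C * ‖p‖ := (hC _ _).1.trans (by gcongr)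
    have a2 : |d₂ z.1 p.1| ≤ C * ‖p‖ ^ 2 := (hC _ _).2.trans (by gcongr)
    have a2' : |d₂ z.2 p.2| ≤ C * ‖p‖ ^ 2 := (hC _ _).2.trans (by gcongr)
    have e0 : |Real.exp (l * F z.2)| ≤ E * Real.exp (|l| * C * ‖z‖) := by
      rw [Real.abs_exp, hE, ← Real.exp_add, Real.exp_le_exp]
      calc l * F z.2 ≤ |l| * |F z.2| := by rw [← abs_mul]; exact le_abs_self _
        _ ≤ |l| * (|F 0| + C * ‖z‖) := by
          gcongr
          exact (hF z.2).trans (by gcongr)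
        _ = _ := by ring
    have fin : ∀ {X Y B : ℝ}, |X| ≤ B * Y * Real.exp ‖z‖ → 0 ≤ B → 0 ≤ Y → ∀ T, B ≤ T →
        |X * Real.exp (l * F z.2)| ≤ T * E * Y * Real.exp ((1 + |l| * C) * ‖z‖) := by
      intro X Y B hX hB hY T hT
      rw [abs_mul, add_mul, one_mul, Real.exp_add]
      calc |X| * |Real.exp (l * F z.2)| ≤ (B * Y * Real.exp ‖z‖) *
            (E * Real.exp (|l| * C * ‖z‖)) := by gcongr
        _ = B * (E * Y * (Real.exp ‖z‖ * Real.exp (|l| * C * ‖z‖))) := by ring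
        _ ≤ T * (E * Y * (Real.exp ‖z‖ * Real.exp (|l| * C * ‖z‖))) := by gcongr
        _ = _ := by ring
    have p1 : 0 ≤ |α| * C + A * (|l| * C) := by positivity
    have p2 : 0 ≤ |α| * C + 2 * (|α| * |l| * (C * C)) + A * (|l| * C + (|l| * C) ^ 2) := by
      positivity
    refine ⟨?_, ?_, ?_⟩
    · have := fin (Y := 1) (by rw [mul_one]; exact a0) hA0 zero_le_one _
        (by linarith : A ≤ A + (|α| * C + A * (|l| * C)) + (|α| * C + 2 * (|α| * |l| * (C * C))
          + A * (|l| * C + (|l| * C) ^ 2)))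
      rwa [mul_one] at this
    · refine fin (B := |α| * C + A * (|l| * C)) ?_ p1 (norm_nonneg p) _ (by linarith)
      calc _ ≤ |α| * |d₁ z.1 p.1| + |α * F z.1 + β| * (|l| * |d₁ z.2 p.2|) := by
            refine (abs_add_le _ _).trans ?_
            rw [abs_mul, abs_mul, abs_mul l]
        _ ≤ |α| * (C * ‖p‖ * Real.exp ‖z‖) + (A * Real.exp ‖z‖) * (|l| * (C * ‖p‖)) := by
            have : |d₁ z.1 p.1| ≤ C * ‖p‖ * Real.exp ‖z‖ :=
              a1.trans (le_mul_of_one_le_right (by positivity) h1)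
            gcongr
        _ = _ := by ring
    · refine fin (B := |α| * C + 2 * (|α| * |l| * (C * C)) + A * (|l| * C + (|l| * C) ^ 2)) ?_ p2
        (by positivity) _ (by linarith)
      calc _ ≤ |α| * |d₂ z.1 p.1| + 2 * (|α| * |l| * (|d₁ z.1 p.1| * |d₁ z.2 p.2|))
            + |α * F z.1 + β| * (|l| * |d₂ z.2 p.2| + (|l| * |d₁ z.2 p.2|) ^ 2) := by
            refine (abs_add_le _ _).trans (add_le_add ((abs_add_le _ _).trans ?_) ?_)
            · rw [abs_mul, abs_mul, abs_mul, abs_mul, abs_mul, abs_two]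
            · rw [abs_mul]
              gcongr
              refine (abs_add_le _ _).trans ?_
              rw [abs_pow, abs_mul, abs_mul]
        _ ≤ |α| * (C * ‖p‖ ^ 2) * Real.exp ‖z‖
            + 2 * (|α| * |l| * ((C * ‖p‖) * (C * ‖p‖))) * Real.exp ‖z‖
            + (A * Real.exp ‖z‖) * (|l| * (C * ‖p‖ ^ 2) + (|l| * (C * ‖p‖)) ^ 2) := by
            refine add_le_add (add_le_add ?_ ?_) ?_
            · exact (mul_le_mul_of_nonneg_left a2 (abs_nonneg _)).trans
                (le_mul_of_one_le_right (by positivity) h1)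
            · refine le_trans ?_ (le_mul_of_one_le_right (by positivity) h1)
              gcongr
            · gcongr
        _ = _ := by ring

end BoundedSecondOrder

/-! ### Gaussian concentration by covariance interpolation -/

section Concentration

variable {κ : Type*} [Fintype κ]

/-- A function on `κ → ℝ` that is `L`-Lipschitz for the Euclidean norm has gradients with inner
products at most `L²`. -/
def GradientBound [DecidableEq κ] (d₁ : (κ → ℝ) → (κ → ℝ) → ℝ) (L : ℝ) : Prop :=
  ∀ a b, ∑ k, d₁ a (Pi.single k 1) * d₁ b (Pi.single k 1) ≤ L ^ 2

namespace BoundedSecondOrder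

variable {F : (κ → ℝ) → ℝ} {d₁ d₂ : (κ → ℝ) → (κ → ℝ) → ℝ}

lemma integrable_exp (h : BoundedSecondOrder F d₁ d₂) (l : ℝ) :
    Integrable (fun x => Real.exp (l * F x)) (gaussPi κ) := by
  obtain ⟨C, hC0, hC, hF⟩ := h.exists_linear_growth
  have hc := h.contDiff.continuous
  refine integrable_of_exp_growth (C := Real.exp (|l| * |F 0|)) (D := |l| * C)
    (by fun_prop) fun x => ?_
  have hx : ‖x‖ ≤ ∑ k, |x k| := by
    refine (pi_norm_le_iff_of_nonneg (Finset.sum_nonneg fun _ _ => abs_nonneg _)).2 fun k => ?_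
    exact Finset.single_le_sum (f := fun k => |x k|) (fun _ _ => abs_nonneg _)
      (Finset.mem_univ k)
  rw [Real.abs_exp, ← Real.exp_add, Real.exp_le_exp]
  calc l * F x ≤ |l| * |F x| := by rw [← abs_mul]; exact le_abs_self _
    _ ≤ |l| * (|F 0| + C * ∑ k, |x k|) := by
      gcongr
      exact (hF x).trans (by gcongr)
    _ = _ := by ring

lemma sum_smul_single [DecidableEq κ] (x : κ → ℝ) : ∑ k, x k • (Pi.single k 1 : κ → ℝ) = x := by
  ext j
  simp [Finset.sum_apply, Pi.single_apply]

/-- Covariance inequality for a Lipschitz function and its exponential. -/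
theorem integral_mul_exp_le [DecidableEq κ] (h : BoundedSecondOrder F d₁ d₂) {L : ℝ} (hL : GradientBound d₁ L)
    {l : ℝ} (hl : 0 ≤ l) :
    ∫ x, F x * Real.exp (l * F x) ∂(gaussPi κ) ≤
      ((∫ x, F x ∂(gaussPi κ)) + l * L ^ 2) * ∫ x, Real.exp (l * F x) ∂(gaussPi κ) := by
  -- The family `p` generates two independent copies `(x, y)`, and `q` the fully correlated pair
  -- `(x, x)`; interpolating between them measures the covariance of `F` and `exp (l F)`.
  set p : κ ⊕ κ → (κ → ℝ) × (κ → ℝ) :=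
    Sum.elim (fun k => (Pi.single k 1, 0)) (fun k => (0, Pi.single k 1)) with hp
  set q : κ → (κ → ℝ) × (κ → ℝ) := fun k => (Pi.single k 1, Pi.single k 1) with hq
  have hsq : ∀ x : κ → ℝ, ∑ k, x k • q k = (x, x) := fun x => by
    refine Prod.ext ?_ ?_ <;>
    · simp only [hq, Prod.smul_mk, Prod.fst_sum, Prod.snd_sum]
      exact sum_smul_single x
  have hsp : ∀ x : κ ⊕ κ → ℝ, ∑ k, x k • p k
      = ((fun k => x (Sum.inl k)), fun k => x (Sum.inr k)) := fun x => by
    rw [Fintype.sum_sum_type]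
    refine Prod.ext ?_ ?_
    · simp only [hp, Sum.elim_inl, Sum.elim_inr, Prod.smul_mk, Prod.fst_add, Prod.fst_sum,
        smul_zero, Finset.sum_const_zero, add_zero]
      exact sum_smul_single _
    · simp only [hp, Sum.elim_inl, Sum.elim_inr, Prod.smul_mk, Prod.snd_add, Prod.snd_sum,
        smul_zero, Finset.sum_const_zero, zero_add]
      exact sum_smul_single _
  have hc := h.contDiff.continuous
  -- The second block is standard Gaussian at every `θ`, so the mean of the exponential does not
  -- move. On the level of Laplacians, a function of the second block alone does not see the
  -- correlation.
  have hconst := fun θ => (h.exp_tilt 0 1 l).integral_rotation_eq p q (fun z => by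
    simp only [hp, hq, Fintype.sum_sum_type, Sum.elim_inl, Sum.elim_inr, h.d₁_zero, h.d₂_zero]
    simp) θ
  simp only [hsq, zero_mul, zero_add, one_mul] at hconst
  set c := ∫ x, Real.exp (l * F x) ∂(gaussPi κ) with hcdef
  have key := (h.exp_tilt 1 0 l).integral_le_add p q (B := l * L ^ 2 * c) (fun θ => ?_)
  · simp only [hsq, hsp, one_mul, add_zero] at key
    rw [integral_gaussPi_sum (f := fun z : (κ → ℝ) × (κ → ℝ) => F z.1 * Real.exp (l * F z.2))
      (by fun_prop), integral_prod_mul (μ := gaussPi κ) (ν := gaussPi κ) F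
        (fun y => Real.exp (l * F y))] at key
    linarith
  · rw [← hconst θ, ← integral_const_mul, ← integral_const_mul]
    have i1 : ∀ v, Integrable _ _ := fun v => (h.exp_tilt 1 0 l).integrable_d₂ (Sum.elim p q)
      (abs_weight_le θ) v
    refine integral_mono ((integrable_finsetSum _ fun k _ => i1 _).sub
      (integrable_finsetSum _ fun k _ => i1 _)) ?_ fun x => ?_
    · have := (h.exp_tilt 0 1 l).integrable (Sum.elim p q) (abs_weight_le θ)
      simp only [zero_mul, zero_add, one_mul] at this
      exact (this.const_mul _).const_mul _
    · simp only [hp, hq, Fintype.sum_sum_type, Sum.elim_inl, Sum.elim_inr, h.d₁_zero, h.d₂_zero]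
      set z := rotationPath p q θ x
      have := hL z.1 z.2
      -- The pure second derivatives cancel; only the mixed term pairing the gradients at the two
      -- points survives. This is why `GradientBound` involves two different points.
      calc _ = 2 * (l * (∑ k, d₁ z.1 (Pi.single k 1) * d₁ z.2 (Pi.single k 1))
            * Real.exp (l * F z.2)) := by
            simp only [Finset.mul_sum, Finset.sum_mul, ← Finset.sum_add_distrib,
              ← Finset.sum_sub_distrib]
            refine Finset.sum_congr rfl fun k _ => ?_
            ring
        _ ≤ 2 * (l * L ^ 2 * Real.exp (l * F z.2)) := by gcongr

/-- Sub-Gaussian bound for the cumulant generating function of a Lipschitz function. -/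
theorem cgf_le [DecidableEq κ] (h : BoundedSecondOrder F d₁ d₂) {L : ℝ} (hL : GradientBound d₁ L)
    {l : ℝ} (hl : 0 ≤ l) :
    cgf F (gaussPi κ) l ≤ l * (∫ x, F x ∂(gaussPi κ)) + l ^ 2 * L ^ 2 / 2 := by
  have hint : ∀ v, v ∈ interior (integrableExpSet F (gaussPi κ)) := fun v => by
    have : integrableExpSet F (gaussPi κ) = univ := eq_univ_of_forall fun t => h.integrable_exp t
    simp [this]
  set M := ∫ x, F x ∂(gaussPi κ) with hM
  -- The derivative of the cumulant generating function is the tilted mean of `F`, at most `M + v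
  -- L²` by the covariance inequality; integrating from `0` gives the quadratic bound.
  have hd : ∀ v, HasDerivAt (fun v => cgf F (gaussPi κ) v - (v * M + v ^ 2 * L ^ 2 / 2))
      ((∫ x, F x * Real.exp (v * F x) ∂(gaussPi κ)) / mgf F (gaussPi κ) v
        - (M + v * L ^ 2)) v := fun v => by
    have h1 := (analyticAt_cgf (hint v)).differentiableAt.hasDerivAt
    rw [deriv_cgf (hint v)] at h1
    refine h1.sub ?_
    have h2 := (((hasDerivAt_pow 2 v).mul_const (L ^ 2)).div_const 2)
    refine (((hasDerivAt_id v).mul_const M).add h2).congr_deriv ?_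
    norm_num
    ring
  have hanti := antitoneOn_of_deriv_nonpos (convex_Ici 0)
    (f := fun v => cgf F (gaussPi κ) v - (v * M + v ^ 2 * L ^ 2 / 2))
    (fun v _ => (hd v).continuousAt.continuousWithinAt)
    (fun v _ => (hd v).differentiableAt.differentiableWithinAt) (fun v hv => by
      rw [interior_Ici] at hv
      rw [(hd v).deriv, sub_nonpos, div_le_iff₀ (mgf_pos (h.integrable_exp v))]
      exact h.integral_mul_exp_le hL (le_of_lt hv))
  have := hanti (mem_Ici.2 le_rfl) (mem_Ici.2 hl) hl
  simp only [cgf_zero] at this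
  linarith

/-- Gaussian concentration of Lipschitz functions. -/
theorem measure_ge_le [DecidableEq κ] (h : BoundedSecondOrder F d₁ d₂) {L : ℝ} (hL : GradientBound d₁ L)
    (hL0 : 0 < L) {M t : ℝ} (hM : ∫ x, F x ∂(gaussPi κ) ≤ M) (ht : 0 ≤ t) :
    (gaussPi κ).real {x | M + t ≤ F x} ≤ Real.exp (-t ^ 2 / (2 * L ^ 2)) := by
  -- The Chernoff parameter `t / L²` minimizes `-l t + l² L² / 2`.
  have hl : 0 ≤ t / L ^ 2 := by positivity
  refine (measure_ge_le_exp_cgf (M + t) hl (h.integrable_exp _)).trans ?_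
  rw [Real.exp_le_exp]
  have h1 := h.cgf_le hL hl
  have h2 := mul_le_mul_of_nonneg_left hM hl
  have h3 : -(t / L ^ 2) * (M + t) + (t / L ^ 2 * M + (t / L ^ 2) ^ 2 * L ^ 2 / 2)
      = -t ^ 2 / (2 * L ^ 2) := by
    field_simp
    ring
  linarith

end BoundedSecondOrder

end Concentration

/-! ### The soft maximum and its derivatives -/

section LogSumExp

variable {V : Type*} {ι : Type*} [Fintype ι]

/-- `β⁻¹ log ∑ exp (β fᵢ)`, a smooth approximation of the maximum. -/
def lse (β : ℝ) (f : ι → V → ℝ) (z : V) : ℝ := β⁻¹ * Real.log (∑ i, Real.exp (β * f i z))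

/-- The weights of the gradient of `lse`. -/
def softmax (β : ℝ) (f : ι → V → ℝ) (z : V) (i : ι) : ℝ :=
  Real.exp (β * f i z) / ∑ j, Real.exp (β * f j z)

variable {β : ℝ} {f : ι → V → ℝ}

lemma sum_exp_pos [Nonempty ι] (β : ℝ) (f : ι → V → ℝ) (z : V) :
    0 < ∑ i, Real.exp (β * f i z) :=
  Finset.sum_pos (fun _ _ => Real.exp_pos _) Finset.univ_nonempty

lemma softmax_nonneg (z : V) (i : ι) : 0 ≤ softmax β f z i :=
  div_nonneg (Real.exp_pos _).le (Finset.sum_nonneg fun _ _ => (Real.exp_pos _).le)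

lemma sum_softmax [Nonempty ι] (z : V) : ∑ i, softmax β f z i = 1 := by
  simp only [softmax, ← Finset.sum_div]
  exact div_self (sum_exp_pos β f z).ne'

lemma le_lse (hβ : 0 < β) (z : V) (i : ι) : f i z ≤ lse β f z := by
  have h : β * f i z ≤ Real.log (∑ i, Real.exp (β * f i z)) := by
    rw [← Real.log_exp (β * f i z)]
    exact Real.log_le_log (Real.exp_pos _)
      (Finset.single_le_sum (f := fun i => Real.exp (β * f i z))
        (fun _ _ => (Real.exp_pos _).le) (Finset.mem_univ i))
  rw [lse, inv_mul_eq_div, le_div_iff₀ hβ]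
  linarith

lemma lse_le [Nonempty ι] (hβ : 0 < β) (z : V) {B : ℝ} (hB : ∀ i, f i z ≤ B) :
    lse β f z ≤ Real.log (Fintype.card ι) / β + B := by
  have h : ∑ i, Real.exp (β * f i z) ≤ Fintype.card ι * Real.exp (β * B) := by
    calc _ ≤ ∑ _i : ι, Real.exp (β * B) := Finset.sum_le_sum fun i _ => by
          rw [Real.exp_le_exp]; exact mul_le_mul_of_nonneg_left (hB i) hβ.le
      _ = _ := by simp
  have h2 := Real.log_le_log (sum_exp_pos β f z) h
  rw [Real.log_mul (by simp) (Real.exp_pos _).ne', Real.log_exp] at h2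
  rw [lse, inv_mul_eq_div, div_add' _ _ _ hβ.ne', div_le_div_iff_of_pos_right hβ]
  linarith

lemma abs_sum_softmax_mul_le [Nonempty ι] (z : V) {c : ι → ℝ} {B : ℝ} (hc : ∀ i, |c i| ≤ B) :
    |∑ i, softmax β f z i * c i| ≤ B := by
  calc _ ≤ ∑ i, |softmax β f z i * c i| := Finset.abs_sum_le_sum_abs _ _
    _ ≤ ∑ i, softmax β f z i * B := Finset.sum_le_sum fun i _ => by
        rw [abs_mul, abs_of_nonneg (softmax_nonneg z i)]
        exact mul_le_mul_of_nonneg_left (hc i) (softmax_nonneg z i)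
    _ = B := by rw [← Finset.sum_mul, sum_softmax, one_mul]

/-- The variance of `c` under the probability weights `softmax` is nonnegative. -/
lemma sq_sum_softmax_mul_le [Nonempty ι] (z : V) (c : ι → ℝ) :
    (∑ i, softmax β f z i * c i) ^ 2 ≤ ∑ i, softmax β f z i * c i ^ 2 := by
  have h : 0 ≤ ∑ i, softmax β f z i * (c i - ∑ j, softmax β f z j * c j) ^ 2 :=
    Finset.sum_nonneg fun i _ => mul_nonneg (softmax_nonneg z i) (sq_nonneg _)
  set S := ∑ j, softmax β f z j * c j with hS
  have e : ∑ i, softmax β f z i * (c i - S) ^ 2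
      = ∑ i, softmax β f z i * c i ^ 2 - S ^ 2 := by
    calc _ = ∑ i, (softmax β f z i * c i ^ 2 - 2 * S * (softmax β f z i * c i)
          + S ^ 2 * softmax β f z i) := Finset.sum_congr rfl fun i _ => by ring
      _ = _ := by
        rw [Finset.sum_add_distrib, Finset.sum_sub_distrib, ← Finset.mul_sum, ← Finset.mul_sum,
          sum_softmax, ← hS]
        ring
  linarith

variable [NormedAddCommGroup V] [NormedSpace ℝ V] {f₁ f₂ : ι → V → V → ℝ}

lemma hasDerivAt_softmax [Nonempty ι]
    (hd : ∀ i z p, HasDerivAt (fun s : ℝ => f i (z + s • p)) (f₁ i z p) 0) (z p : V) (i : ι) :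
    HasDerivAt (fun s : ℝ => softmax β f (z + s • p) i)
      (β * softmax β f z i * (f₁ i z p - ∑ j, softmax β f z j * f₁ j z p)) 0 := by
  have h1 : ∀ j, HasDerivAt (fun s : ℝ => Real.exp (β * f j (z + s • p)))
      (Real.exp (β * f j z) * (β * f₁ j z p)) 0 := fun j => by
    simpa using ((hd j z p).const_mul β).exp
  have h2 : HasDerivAt (fun s : ℝ => ∑ j, Real.exp (β * f j (z + s • p)))
      (∑ j, Real.exp (β * f j z) * (β * f₁ j z p)) 0 := HasDerivAt.fun_sum fun j _ => h1 j
  refine ((h1 i).div h2 (sum_exp_pos β f _).ne').congr_deriv ?_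
  simp only [zero_smul, add_zero]
  have e : ∑ j, softmax β f z j * f₁ j z p
      = (∑ j, Real.exp (β * f j z) * f₁ j z p) / ∑ j, Real.exp (β * f j z) := by
    rw [Finset.sum_div]
    exact Finset.sum_congr rfl fun j _ => by rw [softmax]; ring
  have e' : ∑ j, Real.exp (β * f j z) * (β * f₁ j z p)
      = β * ∑ j, Real.exp (β * f j z) * f₁ j z p := by
    rw [Finset.mul_sum]
    exact Finset.sum_congr rfl fun j _ => by ring
  rw [e, e', softmax]
  field_simp

/-- The first derivative of `lse` in terms of those of the `fᵢ`. -/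
def lse₁ (β : ℝ) (f : ι → V → ℝ) (f₁ : ι → V → V → ℝ) (z p : V) : ℝ :=
  ∑ i, softmax β f z i * f₁ i z p

/-- The second derivative of `lse` in terms of the derivatives of the `fᵢ`. -/
def lse₂ (β : ℝ) (f : ι → V → ℝ) (f₁ f₂ : ι → V → V → ℝ) (z p : V) : ℝ :=
  β * (∑ i, softmax β f z i * f₁ i z p ^ 2 - (∑ i, softmax β f z i * f₁ i z p) ^ 2)
    + ∑ i, softmax β f z i * f₂ i z p

theorem BoundedSecondOrder.lse [Nonempty ι] (h : ∀ i, BoundedSecondOrder (f i) (f₁ i) (f₂ i))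
    (hβ : 0 < β) :
    BoundedSecondOrder (PGD.lse β f) (lse₁ β f f₁) (lse₂ β f f₁ f₂) where
  contDiff := by
    have hc := fun i => (h i).contDiff
    unfold PGD.lse
    refine contDiff_const.mul (ContDiff.log (by fun_prop) fun z => (sum_exp_pos β f z).ne')
  hasDerivAt z p := by
    have h1 : ∀ j, HasDerivAt (fun s : ℝ => Real.exp (β * f j (z + s • p)))
        (Real.exp (β * f j z) * (β * f₁ j z p)) 0 := fun j => by
      simpa using (((h j).hasDerivAt z p).const_mul β).exp
    have h2 : HasDerivAt (fun s : ℝ => ∑ j, Real.exp (β * f j (z + s • p)))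
        (∑ j, Real.exp (β * f j z) * (β * f₁ j z p)) 0 := HasDerivAt.fun_sum fun j _ => h1 j
    refine ((h2.log (sum_exp_pos β f _).ne').const_mul β⁻¹).congr_deriv ?_
    simp only [zero_smul, add_zero, lse₁, softmax]
    rw [Finset.sum_div, Finset.mul_sum]
    refine Finset.sum_congr rfl fun j _ => ?_
    field_simp
  hasDerivAt' z p := by
    have h1 : ∀ j, HasDerivAt (fun s : ℝ => softmax β f (z + s • p) j * f₁ j (z + s • p) p)
        (β * softmax β f z j * (f₁ j z p - ∑ j, softmax β f z j * f₁ j z p) * f₁ j z p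
          + softmax β f z j * f₂ j z p) 0 := fun j => by
      refine ((hasDerivAt_softmax (fun i => (h i).hasDerivAt) z p j).fun_mul
        ((h j).hasDerivAt' z p)).congr_deriv ?_
      simp
    refine (HasDerivAt.fun_sum fun j _ => h1 j).congr_deriv ?_
    rw [lse₂, Finset.sum_add_distrib]
    congr 1
    set S := ∑ j, softmax β f z j * f₁ j z p with hS
    calc _ = ∑ i, (β * (softmax β f z i * f₁ i z p ^ 2)
          - β * S * (softmax β f z i * f₁ i z p)) := Finset.sum_congr rfl fun i _ => by ring
      _ = _ := by
        rw [Finset.sum_sub_distrib, ← Finset.mul_sum, ← Finset.mul_sum, ← hS]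
        ring
  bound := by
    choose C hC0 hC using fun i => (h i).bound
    set D := ∑ i, C i with hD
    have hD0 : 0 ≤ D := Finset.sum_nonneg fun i _ => hC0 i
    have hCD : ∀ i, C i ≤ D := fun i =>
      Finset.single_le_sum (fun i _ => hC0 i) (Finset.mem_univ i)
    refine ⟨D + β * (D ^ 2 + D ^ 2), by positivity, fun z p => ?_⟩
    have b1 : ∀ i, |f₁ i z p| ≤ D * ‖p‖ := fun i => ((hC i z p).1).trans (by gcongr; exact hCD i)
    have b2 : ∀ i, |f₂ i z p| ≤ D * ‖p‖ ^ 2 := fun i =>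
      ((hC i z p).2).trans (by gcongr; exact hCD i)
    have b3 : ∀ i, |f₁ i z p ^ 2| ≤ (D * ‖p‖) ^ 2 := fun i => by
      rw [abs_pow]; gcongr; exact b1 i
    have c1 := abs_sum_softmax_mul_le (β := β) (f := f) z b1
    have c2 := abs_sum_softmax_mul_le (β := β) (f := f) z b2
    have c3 := abs_sum_softmax_mul_le (β := β) (f := f) z b3
    refine ⟨c1.trans ?_, ?_⟩
    · gcongr
      exact le_add_of_nonneg_right (by positivity)
    · have c4 : |(∑ i, softmax β f z i * f₁ i z p) ^ 2| ≤ (D * ‖p‖) ^ 2 := by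
        rw [abs_pow]; gcongr
      rw [lse₂]
      calc _ ≤ β * ((D * ‖p‖) ^ 2 + (D * ‖p‖) ^ 2) + D * ‖p‖ ^ 2 := by
            refine (abs_add_le _ _).trans (add_le_add ?_ c2)
            rw [abs_mul, abs_of_pos hβ]
            exact mul_le_mul_of_nonneg_left ((abs_sub _ _).trans (add_le_add c3 c4)) hβ.le
        _ = _ := by ring

end LogSumExp

/-! ### A smooth approximation of the Euclidean norm -/

section SmoothNorm

variable {E : Type*} [NormedAddCommGroup E]

/-- `√(c + ‖z‖²)`, a smooth approximation of the norm. -/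
def smoothNorm (c : ℝ) (z : E) : ℝ := Real.sqrt (c + ‖z‖ ^ 2)

lemma smoothNorm_pos {c : ℝ} (hc : 0 < c) (z : E) : 0 < smoothNorm c z :=
  Real.sqrt_pos.2 (by positivity)

lemma norm_le_smoothNorm {c : ℝ} (hc : 0 < c) (z : E) : ‖z‖ ≤ smoothNorm c z :=
  Real.le_sqrt_of_sq_le (by linarith)

lemma smoothNorm_le {c : ℝ} (hc : 0 < c) (z : E) : smoothNorm c z ≤ Real.sqrt c + ‖z‖ := by
  refine Real.sqrt_le_iff.2 ⟨by positivity, ?_⟩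
  have := Real.sq_sqrt hc.le
  nlinarith [Real.sqrt_nonneg c, norm_nonneg z, mul_nonneg (Real.sqrt_nonneg c) (norm_nonneg z)]

lemma sqrt_le_smoothNorm (c : ℝ) (z : E) : Real.sqrt c ≤ smoothNorm c z :=
  Real.sqrt_le_sqrt (by nlinarith [norm_nonneg z])

variable [InnerProductSpace ℝ E]

lemma norm_inv_smoothNorm_smul_le {c : ℝ} (hc : 0 < c) (z : E) :
    ‖(smoothNorm c z)⁻¹ • z‖ ≤ 1 := by
  rw [norm_smul, norm_inv, Real.norm_of_nonneg (smoothNorm_pos hc z).le, inv_mul_le_iff₀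
    (smoothNorm_pos hc z), mul_one]
  exact norm_le_smoothNorm hc z

lemma hasDerivAt_smoothNorm {c : ℝ} (hc : 0 < c) (z p : E) :
    HasDerivAt (fun s : ℝ => smoothNorm c (z + s • p)) (inner ℝ z p / smoothNorm c z) 0 := by
  have h1 : HasDerivAt (fun s : ℝ => z + s • p) p 0 := by
    simpa using ((hasDerivAt_id (0 : ℝ)).smul_const p).const_add z
  have h2 := ((h1.norm_sq).const_add c).sqrt (by positivity)
  refine h2.congr_deriv ?_
  simp only [zero_smul, add_zero, smoothNorm]
  field_simp

theorem boundedSecondOrder_smoothNorm {c : ℝ} (hc : 0 < c) :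
    BoundedSecondOrder (smoothNorm c (E := E)) (fun z p => inner ℝ z p / smoothNorm c z)
      (fun z p => (‖p‖ ^ 2 - (inner ℝ z p / smoothNorm c z) ^ 2) / smoothNorm c z) where
  contDiff := by
    unfold smoothNorm
    exact ContDiff.sqrt (contDiff_const.add (contDiff_norm_sq ℝ)) fun z => by positivity
  hasDerivAt := hasDerivAt_smoothNorm hc
  hasDerivAt' z p := by
    have h1 : HasDerivAt (fun s : ℝ => z + s • p) p 0 := by
      simpa using ((hasDerivAt_id (0 : ℝ)).smul_const p).const_add z
    have h2 := h1.inner ℝ (hasDerivAt_const (0 : ℝ) p)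
    refine (h2.div (hasDerivAt_smoothNorm hc z p) (smoothNorm_pos hc _).ne').congr_deriv ?_
    have := (smoothNorm_pos hc z).ne'
    simp only [zero_smul, add_zero, inner_zero_right, zero_add, real_inner_self_eq_norm_sq]
    field_simp
  bound := by
    have hs := Real.sqrt_pos.2 hc
    refine ⟨1 + (Real.sqrt c)⁻¹, by positivity, fun z p => ?_⟩
    have hN := smoothNorm_pos hc z
    have h1 : |inner ℝ z p / smoothNorm c z| ≤ ‖p‖ := by
      rw [abs_div, abs_of_pos hN, div_le_iff₀ hN]
      exact (abs_real_inner_le_norm z p).trans (by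
        rw [mul_comm]; gcongr; exact norm_le_smoothNorm hc z)
    refine ⟨h1.trans ?_, ?_⟩
    · rw [add_mul, one_mul]
      exact le_add_of_nonneg_right (by positivity)
    · have h2 : (inner ℝ z p / smoothNorm c z) ^ 2 ≤ ‖p‖ ^ 2 := by
        rw [← sq_abs]; gcongr
      rw [abs_div, abs_of_pos hN, abs_of_nonneg (by linarith), div_eq_inv_mul]
      have h3 : (smoothNorm c z)⁻¹ ≤ 1 + (Real.sqrt c)⁻¹ :=
        (inv_anti₀ hs (sqrt_le_smoothNorm c z)).trans (by linarith)
      have h4 : 0 ≤ (inner ℝ z p / smoothNorm c z) ^ 2 := sq_nonneg _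
      gcongr
      linarith

/-- `s √(c + ‖y‖²) + t - a` as a function of `(y, t)`. -/
lemma boundedSecondOrder_smoothNorm_affine {c : ℝ} (hc : 0 < c) (s a : ℝ) :
    BoundedSecondOrder (fun z : E × ℝ => s * smoothNorm c z.1 + z.2 - a)
      (fun z p => s * (inner ℝ z.1 p.1 / smoothNorm c z.1) + p.2)
      (fun z p => s * ((‖p.1‖ ^ 2 - (inner ℝ z.1 p.1 / smoothNorm c z.1) ^ 2)
        / smoothNorm c z.1)) where
  contDiff := by
    have := (boundedSecondOrder_smoothNorm (E := E) hc).contDiff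
    fun_prop
  hasDerivAt z p := by
    have h1 := (boundedSecondOrder_smoothNorm hc).hasDerivAt z.1 p.1
    have h2 : HasDerivAt (fun s : ℝ => (z + s • p).2) p.2 0 := by
      simpa using ((hasDerivAt_id (0 : ℝ)).mul_const p.2).const_add z.2
    exact ((h1.const_mul s).add h2).sub_const a
  hasDerivAt' z p := by
    have h1 := (boundedSecondOrder_smoothNorm hc).hasDerivAt' z.1 p.1
    exact (h1.const_mul s).add_const _
  bound := by
    obtain ⟨C, hC0, hC⟩ := (boundedSecondOrder_smoothNorm (E := E) hc).bound
    refine ⟨|s| * C + 1, by positivity, fun z p => ⟨?_, ?_⟩⟩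
    · refine (abs_add_le _ _).trans ?_
      rw [abs_mul, add_mul, one_mul, mul_assoc]
      have := norm_snd_le p
      rw [Real.norm_eq_abs] at this
      have h1 := (hC z.1 p.1).1
      have h2 := norm_fst_le p
      gcongr
      exact h1.trans (by gcongr)
    · rw [abs_mul, add_mul, one_mul, mul_assoc]
      have h1 := (hC z.1 p.1).2
      have h2 := norm_fst_le p
      refine le_add_of_le_of_nonneg ?_ (by positivity)
      gcongr
      exact h1.trans (by gcongr)

end SmoothNorm

namespace BoundedSecondOrder

variable {V W : Type*} [NormedAddCommGroup V] [NormedSpace ℝ V] [NormedAddCommGroup W]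
  [NormedSpace ℝ W] {F : V → ℝ} {d₁ d₂ : V → V → ℝ}

lemma comp_clm (h : BoundedSecondOrder F d₁ d₂) (T : W →L[ℝ] V) :
    BoundedSecondOrder (fun z => F (T z)) (fun z p => d₁ (T z) (T p))
      (fun z p => d₂ (T z) (T p)) where
  contDiff := h.contDiff.comp T.contDiff
  hasDerivAt z p := by simpa using h.hasDerivAt (T z) (T p)
  hasDerivAt' z p := by simpa using h.hasDerivAt' (T z) (T p)
  bound := by
    obtain ⟨C, hC0, hC⟩ := h.bound
    refine ⟨C * ‖T‖ + C * ‖T‖ ^ 2, by positivity, fun z p => ⟨((hC _ _).1).trans ?_,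
      ((hC _ _).2).trans ?_⟩⟩
    · calc C * ‖T p‖ ≤ C * (‖T‖ * ‖p‖) := by gcongr; exact T.le_opNorm p
        _ ≤ _ := by
          rw [← mul_assoc]; gcongr; exact le_add_of_nonneg_right (by positivity)
    · calc C * ‖T p‖ ^ 2 ≤ C * (‖T‖ * ‖p‖) ^ 2 := by gcongr; exact T.le_opNorm p
        _ = C * ‖T‖ ^ 2 * ‖p‖ ^ 2 := by ring
        _ ≤ _ := by gcongr; exact le_add_of_nonneg_left (by positivity)

end BoundedSecondOrder

/-! ### Gordon-type comparison for a Gaussian matrix -/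

section Gordon

variable {m n : ℕ} {ι : Type*}

/-- Summed over the coefficient vectors of a Gaussian process, the second derivative of the soft
maximum depends on first derivatives only through their Gram matrix. This is the form in which two
processes are compared. -/
lemma sum_lse₂ [Fintype ι] {V : Type*} {β : ℝ} {f : ι → V → ℝ} {f₁ f₂ : ι → V → V → ℝ} {κ : Type*}
    [Fintype κ] (z : V) (p : κ → V) :
    ∑ k, lse₂ β f f₁ f₂ z (p k) =
      β * (∑ i, softmax β f z i * ∑ k, f₁ i z (p k) * f₁ i z (p k)
        - ∑ i, ∑ j, softmax β f z i * softmax β f z j * ∑ k, f₁ i z (p k) * f₁ j z (p k))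
      + ∑ i, softmax β f z i * ∑ k, f₂ i z (p k) := by
  simp only [lse₂, Finset.sum_add_distrib, ← Finset.mul_sum, Finset.sum_sub_distrib]
  congr 2
  · congr 1
    · rw [Finset.sum_comm]
      refine Finset.sum_congr rfl fun i _ => ?_
      rw [Finset.mul_sum]
      exact Finset.sum_congr rfl fun k _ => by ring
    · simp_rw [sq, Finset.sum_mul_sum, Finset.mul_sum]
      rw [Finset.sum_comm]
      refine Finset.sum_congr rfl fun i _ => ?_
      rw [Finset.sum_comm]
      refine Finset.sum_congr rfl fun j _ => Finset.sum_congr rfl fun k _ => by ring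
  · rw [Finset.sum_comm]
    simp_rw [Finset.mul_sum]

/-- The functions whose soft maximum enters Gordon's comparison. -/
def gordonFun (m : ℕ) (s c b : ℝ) (w : ι → Vec n) (i : ι) (z : ι → Vec m × ℝ) : ℝ :=
  s * smoothNorm c (z i).1 + (z i).2 - s * b * ‖w i‖

/-- The first derivative of `gordonFun`. -/
def gordonFun₁ (m : ℕ) (s c : ℝ) (i : ι) (z p : ι → Vec m × ℝ) : ℝ :=
  s * (inner ℝ (z i).1 (p i).1 / smoothNorm c (z i).1) + (p i).2

/-- The second derivative of `gordonFun`. -/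
def gordonFun₂ (m : ℕ) (s c : ℝ) (i : ι) (z p : ι → Vec m × ℝ) : ℝ :=
  s * ((‖(p i).1‖ ^ 2 - (inner ℝ (z i).1 (p i).1 / smoothNorm c (z i).1) ^ 2)
    / smoothNorm c (z i).1)

lemma boundedSecondOrder_gordonFun [Fintype ι] {s c : ℝ} (hc : 0 < c) (b : ℝ) (w : ι → Vec n) (i : ι) :
    BoundedSecondOrder (gordonFun m s c b w i) (gordonFun₁ m s c i) (gordonFun₂ m s c i) :=
  (boundedSecondOrder_smoothNorm_affine hc s (s * b * ‖w i‖)).comp_clm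
    (ContinuousLinearMap.proj (R := ℝ) (φ := fun _ : ι => Vec m × ℝ) i)

/-- Coefficient vectors of the process `w ↦ (A w, 0)`. -/
def matrixDir (m : ℕ) (w : ι → Vec n) (k : Fin m × Fin n) : ι → Vec m × ℝ :=
  fun i => (w i k.2 • EuclideanSpace.single k.1 (1 : ℝ), 0)

/-- Coefficient vectors of the process `w ↦ (‖w‖ h, ⟨g, w⟩)`. -/
def splitDir (m : ℕ) (w : ι → Vec n) : Fin m ⊕ Fin n → ι → Vec m × ℝ :=
  Sum.elim (fun r i => (‖w i‖ • EuclideanSpace.single r (1 : ℝ), 0)) (fun k i => (0, w i k))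

/-- The normalized vector which is the gradient of `smoothNorm`. -/
def smoothDir (c : ℝ) (y : Vec m) : Vec m := (smoothNorm c y)⁻¹ • y

lemma inner_smul_single_div (c a : ℝ) (y : Vec m) (r : Fin m) :
    inner ℝ y (a • EuclideanSpace.single r (1 : ℝ)) / smoothNorm c y = a * smoothDir c y r := by
  rw [inner_smul_right, EuclideanSpace.inner_single_right]
  simp [smoothDir]
  ring

lemma inner_eq_sum (u v : Vec n) : inner ℝ u v = ∑ k, u k * v k := by
  rw [PiLp.inner_apply]
  exact Finset.sum_congr rfl fun k _ => by simp [mul_comm]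

variable (w : ι → Vec n)

lemma gordonFun₁_matrixDir (s c : ℝ) (i : ι) (z : ι → Vec m × ℝ) (k : Fin m × Fin n) :
    gordonFun₁ m s c i z (matrixDir m w k) = s * (w i k.2 * smoothDir c (z i).1 k.1) := by
  simp only [gordonFun₁, matrixDir, inner_smul_single_div, add_zero]

lemma gordonFun₁_splitDir_inl (s c : ℝ) (i : ι) (z : ι → Vec m × ℝ) (r : Fin m) :
    gordonFun₁ m s c i z (splitDir m w (Sum.inl r)) = s * (‖w i‖ * smoothDir c (z i).1 r) := by
  simp only [gordonFun₁, splitDir, Sum.elim_inl, inner_smul_single_div, add_zero]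

lemma gordonFun₁_splitDir_inr (s c : ℝ) (i : ι) (z : ι → Vec m × ℝ) (k : Fin n) :
    gordonFun₁ m s c i z (splitDir m w (Sum.inr k)) = w i k := by
  simp [gordonFun₁, splitDir]

/-- The covariance of `A w` and `A w'` is `⟨w, w'⟩ I`. Two base points are allowed because the
concentration bound needs gradients at different points. -/
lemma sum_gordonFun₁_matrixDir {s : ℝ} (hs : s ^ 2 = 1) (c : ℝ) (i j : ι)
    (z z' : ι → Vec m × ℝ) :
    ∑ k, gordonFun₁ m s c i z (matrixDir m w k) * gordonFun₁ m s c j z' (matrixDir m w k)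
      = inner ℝ (smoothDir c (z i).1) (smoothDir c (z' j).1) * inner ℝ (w i) (w j) := by
  simp only [gordonFun₁_matrixDir, inner_eq_sum, Finset.sum_mul_sum, Fintype.sum_prod_type]
  refine Finset.sum_congr rfl fun r _ => Finset.sum_congr rfl fun k _ => ?_
  linear_combination (w i k * smoothDir c (z i).1 r * (w j k * smoothDir c (z' j).1 r)) * hs

lemma sum_gordonFun₁_splitDir {s : ℝ} (hs : s ^ 2 = 1) (c : ℝ) (i j : ι) (z : ι → Vec m × ℝ) :
    ∑ k, gordonFun₁ m s c i z (splitDir m w k) * gordonFun₁ m s c j z (splitDir m w k)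
      = ‖w i‖ * ‖w j‖ * inner ℝ (smoothDir c (z i).1) (smoothDir c (z j).1)
        + inner ℝ (w i) (w j) := by
  simp only [Fintype.sum_sum_type, gordonFun₁_splitDir_inl, gordonFun₁_splitDir_inr, inner_eq_sum,
    Finset.mul_sum]
  congr 1
  refine Finset.sum_congr rfl fun r _ => ?_
  linear_combination (‖w i‖ * smoothDir c (z i).1 r * (‖w j‖ * smoothDir c (z j).1 r)) * hs

/-- For a single index the vectors `A w` and `‖w‖ h` have the same covariance `‖w‖² I`, and the
linear coordinate carries no second derivative. -/
lemma sum_gordonFun₂_eq (s c : ℝ) (i : ι) (z : ι → Vec m × ℝ) :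
    ∑ k, gordonFun₂ m s c i z (matrixDir m w k) = ∑ k, gordonFun₂ m s c i z (splitDir m w k) := by
  simp only [Fintype.sum_sum_type, Fintype.sum_prod_type, gordonFun₂, matrixDir, splitDir,
    Sum.elim_inl, Sum.elim_inr, inner_smul_single_div, norm_smul, PiLp.norm_single,
    norm_one, mul_one, norm_zero, inner_zero_right, Real.norm_eq_abs, sq_abs]
  simp only [zero_div, ne_eq, OfNat.ofNat_ne_zero, not_false_eq_true, zero_pow, sub_zero, mul_zero,
    Finset.sum_const_zero, add_zero]
  refine Finset.sum_congr rfl fun r _ => ?_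
  rw [EuclideanSpace.real_norm_sq_eq, mul_pow, EuclideanSpace.real_norm_sq_eq]
  have : ∀ k : Fin n, s * ((w i k ^ 2 - (w i k * smoothDir c (z i).1 r) ^ 2)
      / smoothNorm c (z i).1) = w i k ^ 2 * (s * (1 - smoothDir c (z i).1 r ^ 2)
        / smoothNorm c (z i).1) := fun k => by ring
  simp_rw [this]
  rw [← Finset.sum_mul]
  ring

lemma norm_smoothDir_le {c : ℝ} (hc : 0 < c) (y : Vec m) : ‖smoothDir c y‖ ≤ 1 :=
  norm_inv_smoothNorm_smul_le hc y

lemma inner_smoothDir_le {c : ℝ} (hc : 0 < c) (y y' : Vec m) :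
    |inner ℝ (smoothDir c y) (smoothDir c y')| ≤ 1 :=
  (abs_real_inner_le_norm _ _).trans
    (mul_le_one₀ (norm_smoothDir_le hc y) (norm_nonneg _) (norm_smoothDir_le hc y'))

/-- The matrix with entries `x (r, k)`, acting on a vector. -/
def matVec (x : Fin m × Fin n → ℝ) (u : Vec n) : Vec m :=
  Matrix.toEuclideanLin (Matrix.of fun r k => x (r, k)) u

lemma sum_smul_matrixDir (x : Fin m × Fin n → ℝ) :
    ∑ k, x k • matrixDir m w k = fun i => (matVec x (w i), 0) := by
  funext i
  refine Prod.ext ?_ ?_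
  · ext r
    simp [matrixDir, matVec, Finset.sum_apply, Prod.fst_sum, Fintype.sum_prod_type,
      Matrix.mulVec, dotProduct, Matrix.toEuclideanLin]
    rw [Finset.sum_comm]
    simp [Pi.single_apply]
  · simp [matrixDir, Finset.sum_apply, Prod.snd_sum]

lemma sum_smul_splitDir (y : Fin m ⊕ Fin n → ℝ) :
    ∑ k, y k • splitDir m w k = fun i => (‖w i‖ • WithLp.toLp 2 (fun r => y (Sum.inl r)),
      inner ℝ (WithLp.toLp 2 (fun k => y (Sum.inr k))) (w i)) := by
  funext i
  rw [inner_eq_sum]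
  refine Prod.ext ?_ ?_
  · ext r
    simp [splitDir, Finset.sum_apply, Prod.fst_sum, Pi.single_apply, mul_comm]
  · simp [splitDir, Finset.sum_apply, Prod.snd_sum]

/-- The linear map sending the entries of a matrix to the images of the vectors `w i`. -/
def matrixDirCLM (m : ℕ) (w : ι → Vec n) : (Fin m × Fin n → ℝ) →L[ℝ] (ι → Vec m × ℝ) :=
  ∑ k, (ContinuousLinearMap.proj (R := ℝ) (φ := fun _ : Fin m × Fin n => ℝ) k).smulRight
    (matrixDir m w k)

lemma matrixDirCLM_apply (x : Fin m × Fin n → ℝ) :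
    matrixDirCLM m w x = fun i => (matVec x (w i), 0) := by
  rw [← sum_smul_matrixDir]
  simp [matrixDirCLM]

lemma matrixDirCLM_single (k : Fin m × Fin n) :
    matrixDirCLM m w (Pi.single k 1) = matrixDir m w k := by
  simp [matrixDirCLM, Pi.single_apply]

variable [Fintype ι]

/-- The soft maximum in Gordon's comparison. -/
abbrev gordonLse (m : ℕ) (β s c b : ℝ) (w : ι → Vec n) : (ι → Vec m × ℝ) → ℝ :=
  lse β (gordonFun m s c b w)

lemma boundedSecondOrder_gordonLse [Nonempty ι] {β s c : ℝ} (hβ : 0 < β) (hc : 0 < c) (b : ℝ) :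
    BoundedSecondOrder (gordonLse m β s c b w)
      (lse₁ β (gordonFun m s c b w) (gordonFun₁ m s c))
      (lse₂ β (gordonFun m s c b w) (gordonFun₁ m s c) (gordonFun₂ m s c)) :=
  BoundedSecondOrder.lse (fun i => boundedSecondOrder_gordonFun hc b w i) hβ

/-- Write `π` for the soft maximum weights and `ν i j` for the inner products of the normalized
directions. The right side minus the left is `β` times the sum of the variance of `‖w i‖` under `π`
and the `π`-average of `(‖w i‖ ‖w j‖ - ⟨w i, w j⟩)(1 - ν i j)`. Both are nonnegative, by Jensen and
Cauchy–Schwarz. The sign `s` enters only through `s² = 1`, so upper and lower deviations are treated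
together. -/
lemma sum_lse₂_matrixDir_le [Nonempty ι] {β s c : ℝ} (hβ : 0 < β) (hs : s ^ 2 = 1) (hc : 0 < c)
    (b : ℝ) (z : ι → Vec m × ℝ) :
    ∑ k, lse₂ β (gordonFun m s c b w) (gordonFun₁ m s c) (gordonFun₂ m s c) z (matrixDir m w k)
      ≤ ∑ k, lse₂ β (gordonFun m s c b w) (gordonFun₁ m s c) (gordonFun₂ m s c) z
        (splitDir m w k) := by
  rw [sum_lse₂, sum_lse₂]
  simp only [sum_gordonFun₂_eq, sum_gordonFun₁_splitDir w hs, sum_gordonFun₁_matrixDir w hs]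
  refine add_le_add ?_ le_rfl
  refine mul_le_mul_of_nonneg_left ?_ hβ.le
  set π := softmax β (gordonFun m s c b w) z with hπ
  set ν : ι → ι → ℝ := fun i j => inner ℝ (smoothDir c (z i).1) (smoothDir c (z j).1) with hν
  have hv := sq_sum_softmax_mul_le (β := β) (f := gordonFun m s c b w) z (fun i => ‖w i‖)
  rw [← hπ] at hv
  have hpos : 0 ≤ ∑ i, ∑ j, π i * π j *
      ((‖w i‖ * ‖w j‖ - inner ℝ (w i) (w j)) * (1 - ν i j)) := by
    refine Finset.sum_nonneg fun i _ => Finset.sum_nonneg fun j _ => ?_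
    have h1 : 0 ≤ π i := softmax_nonneg z i
    have h2 : 0 ≤ π j := softmax_nonneg z j
    have h3 := real_inner_le_norm (w i) (w j)
    have h4 : ν i j ≤ 1 := (abs_le.1 (inner_smoothDir_le hc _ _)).2
    exact mul_nonneg (mul_nonneg h1 h2) (mul_nonneg (by linarith) (by linarith))
  have e1 : ∑ i, π i * (‖w i‖ * ‖w i‖ * ν i i + inner ℝ (w i) (w i))
      = ∑ i, π i * (ν i i * inner ℝ (w i) (w i)) + ∑ i, π i * ‖w i‖ ^ 2 := by
    rw [← Finset.sum_add_distrib]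
    refine Finset.sum_congr rfl fun i _ => ?_
    rw [real_inner_self_eq_norm_sq]; ring
  have e2 : ∑ i, ∑ j, π i * π j * (‖w i‖ * ‖w j‖ * ν i j + inner ℝ (w i) (w j))
      = ∑ i, ∑ j, π i * π j * (ν i j * inner ℝ (w i) (w j)) + (∑ i, π i * ‖w i‖) ^ 2
        - ∑ i, ∑ j, π i * π j * ((‖w i‖ * ‖w j‖ - inner ℝ (w i) (w j)) * (1 - ν i j)) := by
    rw [sq, Finset.sum_mul_sum, ← Finset.sum_add_distrib, ← Finset.sum_sub_distrib]
    refine Finset.sum_congr rfl fun i _ => ?_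
    rw [← Finset.sum_add_distrib, ← Finset.sum_sub_distrib]
    refine Finset.sum_congr rfl fun j _ => ?_
    ring
  change ∑ i, π i * (ν i i * inner ℝ (w i) (w i)) -
    ∑ i, ∑ j, π i * π j * (ν i j * inner ℝ (w i) (w j)) ≤
    ∑ i, π i * (‖w i‖ * ‖w i‖ * ν i i + inner ℝ (w i) (w i)) -
    ∑ i, ∑ j, π i * π j * (‖w i‖ * ‖w j‖ * ν i j + inner ℝ (w i) (w j))
  rw [e1, e2]
  linarith

/-- Gordon's comparison inequality for the soft maximum. -/
theorem integral_gordonLse_matVec_le [Nonempty ι] {β s c : ℝ} (hβ : 0 < β) (hs : s ^ 2 = 1)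
    (hc : 0 < c) (b : ℝ) :
    ∫ x, gordonLse m β s c b w (fun i => (matVec x (w i), 0)) ∂(gaussPi (Fin m × Fin n))
      ≤ ∫ y, gordonLse m β s c b w (fun i => (‖w i‖ • WithLp.toLp 2 (fun r => y (Sum.inl r)),
        inner ℝ (WithLp.toLp 2 (fun k => y (Sum.inr k))) (w i)))
          ∂(gaussPi (Fin m ⊕ Fin n)) := by
  have := (boundedSecondOrder_gordonLse (m := m) w (s := s) hβ hc b).secondOrder.integral_le
    (splitDir m w) (matrixDir m w) (sum_lse₂_matrixDir_le w hβ hs hc b)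
  simpa only [sum_smul_matrixDir, sum_smul_splitDir] using this

/-- The gradient is a convex combination of the gradients of the individual functions, and the
latter have pairwise inner products at most `L²`. -/
lemma gradientBound_gordonLse [Nonempty ι] {β s c : ℝ} (hs : s ^ 2 = 1)
    (hc : 0 < c) (b : ℝ) {L : ℝ} (hL : 0 ≤ L) (hw : ∀ i, ‖w i‖ ≤ L) :
    GradientBound (fun z p => lse₁ β (gordonFun m s c b w) (gordonFun₁ m s c)
      (matrixDirCLM m w z) (matrixDirCLM m w p)) L := by
  intro x y
  simp only [matrixDirCLM_single, lse₁]
  set z := matrixDirCLM m w x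
  set z' := matrixDirCLM m w y
  set f := gordonFun m s c b w
  calc ∑ k, (∑ i, softmax β f z i * gordonFun₁ m s c i z (matrixDir m w k))
        * (∑ i, softmax β f z' i * gordonFun₁ m s c i z' (matrixDir m w k))
      = ∑ i, ∑ j, softmax β f z i * softmax β f z' j *
          ∑ k, gordonFun₁ m s c i z (matrixDir m w k) * gordonFun₁ m s c j z' (matrixDir m w k) := by
        simp_rw [Finset.sum_mul_sum, Finset.mul_sum]
        rw [Finset.sum_comm]
        refine Finset.sum_congr rfl fun i _ => ?_
        rw [Finset.sum_comm]
        exact Finset.sum_congr rfl fun j _ => Finset.sum_congr rfl fun k _ => by ring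
    _ ≤ ∑ i, ∑ j, softmax β f z i * softmax β f z' j * L ^ 2 := by
        refine Finset.sum_le_sum fun i _ => Finset.sum_le_sum fun j _ => ?_
        refine mul_le_mul_of_nonneg_left ?_ (mul_nonneg (softmax_nonneg _ _) (softmax_nonneg _ _))
        rw [sum_gordonFun₁_matrixDir w hs]
        have h1 := inner_smoothDir_le hc (z i).1 (z' j).1
        have h2 : |inner ℝ (w i) (w j)| ≤ L ^ 2 := (abs_real_inner_le_norm _ _).trans (by
          rw [sq]; exact mul_le_mul (hw i) (hw j) (norm_nonneg _) hL)
        refine (le_abs_self _).trans ?_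
        rw [abs_mul]
        calc _ ≤ 1 * L ^ 2 := by gcongr
          _ = _ := one_mul _
    _ = L ^ 2 := by
        simp_rw [← Finset.sum_mul, ← Finset.mul_sum, sum_softmax, mul_one, sum_softmax, one_mul]

end Gordon

/-! ### The function `φ` and its inverse -/

section Phi

/-- In Euler's product for `Γ` the powers of `N` and the factorials cancel in this ratio, and `(a -
1/2)(a + 1/2) = a² - 1/4` gives the factors. Each factor lies in `[0, 1]` and increases with `s`,
hence so does the limit `gammaRatio`. -/
lemma gammaSeq_ratio {s : ℝ} (hs : 0 < s) {N : ℕ} (hN : 0 < N) :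
    Real.GammaSeq (s + 1 / 2) N ^ 2 / (Real.GammaSeq s N * Real.GammaSeq (s + 1) N)
      = ∏ j ∈ Finset.range (N + 1), (1 - 1 / (4 * (s + 1 / 2 + j) ^ 2)) := by
  have hN' : (0 : ℝ) < N := by exact_mod_cast hN
  have hp : ∀ t : ℝ, 0 < t → 0 < ∏ j ∈ Finset.range (N + 1), (t + (j : ℝ)) := fun t ht =>
    Finset.prod_pos fun j _ => by positivity
  have e : ((N : ℝ) ^ (s + 1 / 2)) ^ 2 = (N : ℝ) ^ s * (N : ℝ) ^ (s + 1) := by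
    rw [← Real.rpow_natCast, ← Real.rpow_mul hN'.le, ← Real.rpow_add hN']
    congr 1
    push_cast
    ring
  have e2 : ∏ j ∈ Finset.range (N + 1), (1 - 1 / (4 * (s + 1 / 2 + (j : ℝ)) ^ 2))
      = (∏ j ∈ Finset.range (N + 1), (s + (j : ℝ))) * (∏ j ∈ Finset.range (N + 1), (s + 1 + (j : ℝ)))
        / (∏ j ∈ Finset.range (N + 1), (s + 1 / 2 + (j : ℝ))) ^ 2 := by
    rw [← Finset.prod_mul_distrib, ← Finset.prod_pow, ← Finset.prod_div_distrib]
    refine Finset.prod_congr rfl fun j _ => ?_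
    have : s + 1 / 2 + (j : ℝ) ≠ 0 := by positivity
    field_simp
    ring
  rw [e2]
  simp only [Real.GammaSeq]
  rw [div_pow, mul_pow, e]
  field_simp

/-- The ratio `φ(2s)² / (2s)`. -/
def gammaRatio (s : ℝ) : ℝ :=
  Real.Gamma (s + 1 / 2) ^ 2 / (Real.Gamma s * Real.Gamma (s + 1))

lemma tendsto_gammaRatio {s : ℝ} (hs : 0 < s) :
    Filter.Tendsto (fun N : ℕ => ∏ j ∈ Finset.range (N + 1),
      (1 - 1 / (4 * (s + 1 / 2 + (j : ℝ)) ^ 2))) Filter.atTop (nhds (gammaRatio s)) := by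
  have h := (((Real.GammaSeq_tendsto_Gamma (s + 1 / 2)).pow 2).div
    ((Real.GammaSeq_tendsto_Gamma s).mul (Real.GammaSeq_tendsto_Gamma (s + 1)))
      (mul_pos (Real.Gamma_pos_of_pos hs) (Real.Gamma_pos_of_pos (by positivity))).ne')
  refine h.congr' ?_
  filter_upwards [Filter.eventually_gt_atTop 0] with N hN
  exact gammaSeq_ratio hs hN

lemma gammaRatio_factor_nonneg {s : ℝ} (hs : 0 < s) (j : ℕ) :
    0 ≤ 1 - 1 / (4 * (s + 1 / 2 + (j : ℝ)) ^ 2) := by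
  rw [sub_nonneg, div_le_one (by positivity)]
  have : (1 : ℝ) / 2 ≤ s + 1 / 2 + j := by
    have : (0 : ℝ) ≤ j := by positivity
    linarith
  nlinarith

lemma gammaRatio_le_one {s : ℝ} (hs : 0 < s) : gammaRatio s ≤ 1 :=
  le_of_tendsto' (tendsto_gammaRatio hs) fun N =>
    Finset.prod_le_one (fun j _ => gammaRatio_factor_nonneg hs j) fun j _ => by
      have : (0 : ℝ) ≤ 1 / (4 * (s + 1 / 2 + (j : ℝ)) ^ 2) := by positivity
      linarith

lemma gammaRatio_mono {s t : ℝ} (hs : 0 < s) (hst : s ≤ t) : gammaRatio s ≤ gammaRatio t :=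
  le_of_tendsto_of_tendsto' (tendsto_gammaRatio hs) (tendsto_gammaRatio (hs.trans_le hst))
    fun N => Finset.prod_le_prod (fun j _ => gammaRatio_factor_nonneg hs j) fun j _ => by
      gcongr

/-- The default value `Real.Gamma 0 = 0` and division by zero yield the continuous extension. -/
lemma phi_zero : phi 0 = 0 := by simp [phi, Real.Gamma_zero]

lemma phi_pos {t : ℝ} (ht : 0 < t) : 0 < phi t := by
  unfold phi
  positivity

lemma phi_nonneg {t : ℝ} (ht : 0 ≤ t) : 0 ≤ phi t := by
  rcases ht.eq_or_lt with rfl | ht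
  · rw [phi_zero]
  · exact (phi_pos ht).le

lemma phi_sq {t : ℝ} (ht : 0 < t) : phi t ^ 2 = gammaRatio (t / 2) * t := by
  rw [phi, gammaRatio, Real.Gamma_add_one (half_pos ht).ne', div_pow, mul_pow,
    Real.sq_sqrt zero_le_two, show (t + 1) / 2 = t / 2 + 1 / 2 by ring]
  field_simp

lemma phi_sq_le {t : ℝ} (ht : 0 ≤ t) : phi t ^ 2 ≤ t := by
  rcases ht.eq_or_lt with rfl | ht
  · simp [phi_zero]
  · rw [phi_sq ht]
    exact mul_le_of_le_one_left ht.le (gammaRatio_le_one (half_pos ht))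

/-- `φ(t)² / t` is monotone. -/
lemma phi_sq_mul_le {s t : ℝ} (hs : 0 ≤ s) (hst : s ≤ t) (ht : 0 < t) :
    phi s ^ 2 * t ≤ phi t ^ 2 * s := by
  rcases hs.eq_or_lt with rfl | hs
  · simp [phi_zero]
  · rw [phi_sq hs, phi_sq ht]
    have := gammaRatio_mono (half_pos hs) (by linarith : s / 2 ≤ t / 2)
    calc gammaRatio (s / 2) * s * t = gammaRatio (s / 2) * (s * t) := by ring
      _ ≤ gammaRatio (t / 2) * (s * t) := by gcongr
      _ = _ := by ring

lemma phi_mul_phi_add_one {t : ℝ} (ht : 0 < t) : phi t * phi (t + 1) = t := by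
  rw [phi, phi, show (t + 1 + 1) / 2 = t / 2 + 1 by ring, Real.Gamma_add_one (half_pos ht).ne']
  have := Real.mul_self_sqrt (zero_le_two (α := ℝ))
  field_simp
  rw [sq, this]

/-- From `t = φ(t) φ(t+1) ≤ φ(t) √(t+1)` one gets `φ(t)² ≥ t² / (t+1) ≥ t - 1`. For `t = m` it says
that the norm of a Gaussian vector has variance at most `1`. -/
lemma sub_one_le_phi_sq {t : ℝ} (ht : 0 < t) : t - 1 ≤ phi t ^ 2 := by
  have h1 := phi_mul_phi_add_one ht
  have h2 := phi_sq_le (show 0 ≤ t + 1 by positivity)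
  nlinarith

lemma continuousOn_phi : ContinuousOn phi (Ici 0) := by
  intro t ht
  rcases (mem_Ici.1 ht).eq_or_lt with rfl | ht
  · rw [ContinuousWithinAt, phi_zero]
    refine squeeze_zero' (g := Real.sqrt) ?_ ?_ ?_
    · filter_upwards [self_mem_nhdsWithin] with s hs using phi_nonneg hs
    · filter_upwards [self_mem_nhdsWithin] with s hs using Real.le_sqrt_of_sq_le (phi_sq_le hs)
    · have := Real.continuous_sqrt.continuousWithinAt (s := Ici 0) (x := 0)
      rwa [ContinuousWithinAt, Real.sqrt_zero] at this
  · have hG : ∀ s : ℝ, 0 < s → ContinuousAt Real.Gamma s := fun s hs =>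
      (Real.differentiableAt_Gamma fun m => by
        have : (0 : ℝ) ≤ m := by positivity
        linarith).continuousAt
    refine ContinuousAt.continuousWithinAt ?_
    unfold phi
    refine ((continuousAt_const).mul ?_).div ?_ (Real.Gamma_pos_of_pos (half_pos ht)).ne'
    · exact (hG _ (by positivity)).comp (f := fun t : ℝ => (t + 1) / 2) (by fun_prop)
    · exact (hG _ (by positivity)).comp (f := fun t : ℝ => t / 2) (by fun_prop)

/-- Surjectivity is all that is needed of the inverse: below, only `phiInv s ≥ 0` and `φ (phiInv s)
= s` are used. -/
lemma exists_phi_eq {s : ℝ} (hs : 0 ≤ s) : ∃ t ∈ Ici (0 : ℝ), phi t = s := by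
  have h1 := phi_pos one_pos
  -- Since `φ(t)² / t` is nondecreasing, `φ(T)² ≥ φ(1)² T`, and this `T` makes the right side at
  -- least `s²`.
  set T := 1 + s ^ 2 / phi 1 ^ 2 with hT
  have hT1 : 1 ≤ T := le_add_of_nonneg_right (by positivity)
  have hT2 : s ≤ phi T := by
    have h := phi_sq_mul_le zero_le_one hT1 (by linarith)
    rw [mul_one] at h
    refine (sq_le_sq₀ hs (phi_nonneg (by linarith))).1 ?_
    refine le_trans ?_ h
    rw [hT, mul_add, mul_div_cancel₀ _ (by positivity)]
    nlinarith
  obtain ⟨t, ht, e⟩ := intermediate_value_Icc (by linarith : (0 : ℝ) ≤ T)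
    (continuousOn_phi.mono Icc_subset_Ici_self) (show s ∈ Icc (phi 0) (phi T) from
      ⟨by rwa [phi_zero], hT2⟩)
  exact ⟨t, ht.1, e⟩

lemma phiInv_nonneg {s : ℝ} (hs : 0 ≤ s) : 0 ≤ phiInv s :=
  Function.invFunOn_mem (exists_phi_eq hs)

lemma phi_phiInv {s : ℝ} (hs : 0 ≤ s) : phi (phiInv s) = s :=
  Function.invFunOn_eq (exists_phi_eq hs)

end Phi

/-! ### Mean and deviation of the norm of a Gaussian vector -/

section ChiMean

lemma gaussPi_eq_withDensity (κ : Type*) [Fintype κ] :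
    gaussPi κ = volume.withDensity
      (fun x => ENNReal.ofReal (∏ i, gaussianPDFReal 0 1 (x i))) := by
  refine Measure.pi_eq fun S hS => ?_
  rw [withDensity_apply _ (MeasurableSet.univ_pi hS)]
  have hi : ∀ i, Integrable ((S i).indicator (gaussianPDFReal 0 1)) :=
    fun i => (integrable_gaussianPDFReal 0 1).indicator (hS i)
  have e : ∀ x : κ → ℝ, (univ.pi S).indicator
      (fun x => ENNReal.ofReal (∏ i, gaussianPDFReal 0 1 (x i))) x
        = ENNReal.ofReal (∏ i, (S i).indicator (gaussianPDFReal 0 1) (x i)) := fun x => by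
    by_cases hx : x ∈ univ.pi S
    · rw [indicator_of_mem hx]
      congr 1
      exact Finset.prod_congr rfl fun i _ => (indicator_of_mem (hx i (mem_univ i)) _).symm
    · rw [indicator_of_notMem hx]
      simp only [mem_pi, mem_univ, forall_const, not_forall] at hx
      obtain ⟨i, hi⟩ := hx
      rw [Finset.prod_eq_zero (Finset.mem_univ i) (indicator_of_notMem hi _), ENNReal.ofReal_zero]
  rw [← lintegral_indicator (MeasurableSet.univ_pi hS)]
  simp_rw [e]
  rw [volume_pi, ← ofReal_integral_eq_lintegral_ofReal
    (Integrable.fintype_prod (f := fun i => (S i).indicator (gaussianPDFReal 0 1)) hi)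
    (Filter.Eventually.of_forall fun x => Finset.prod_nonneg fun i _ =>
      indicator_nonneg (fun _ _ => gaussianPDFReal_nonneg _ _ _) _),
    integral_fintype_prod_eq_prod (fun i => (S i).indicator (gaussianPDFReal 0 1)),
    ENNReal.ofReal_prod_of_nonneg fun i _ => integral_nonneg fun x =>
      indicator_nonneg (fun _ _ => gaussianPDFReal_nonneg _ _ _) _]
  refine Finset.prod_congr rfl fun i _ => ?_
  rw [integral_indicator (hS i), gaussianReal_apply_eq_integral _ one_ne_zero]

lemma integral_norm_gaussPi (m : ℕ) (g : ℝ → ℝ) :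
    ∫ x : Fin m → ℝ, g ‖(WithLp.toLp 2 x : Vec m)‖ ∂(gaussPi (Fin m))
      = ((√(2 * Real.pi))⁻¹) ^ m * ∫ z : Vec m, Real.exp (-‖z‖ ^ 2 / 2) * g ‖z‖ := by
  rw [gaussPi_eq_withDensity, integral_withDensity_eq_integral_toReal_smul (by fun_prop)
    (Filter.Eventually.of_forall fun x => ENNReal.ofReal_lt_top)]
  have e : ∀ x : Fin m → ℝ, (ENNReal.ofReal (∏ i, gaussianPDFReal 0 1 (x i))).toReal
      • g ‖(WithLp.toLp 2 x : Vec m)‖ = ((√(2 * Real.pi))⁻¹) ^ m *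
        (fun z : Vec m => Real.exp (-‖z‖ ^ 2 / 2) * g ‖z‖) (WithLp.toLp 2 x) := fun x => by
    rw [ENNReal.toReal_ofReal (Finset.prod_nonneg fun i _ => gaussianPDFReal_nonneg _ _ _)]
    simp only [gaussianPDFReal, NNReal.coe_one, mul_one, sub_zero, Finset.prod_mul_distrib,
      Finset.prod_const, Finset.card_univ, Fintype.card_fin, ← Real.exp_sum, smul_eq_mul]
    rw [EuclideanSpace.real_norm_sq_eq, mul_assoc, neg_div, Finset.sum_div]
    simp [neg_div]
  simp_rw [e, integral_const_mul]
  congr 1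
  exact (PiLp.volume_preserving_toLp (Fin m)).integral_comp
    (MeasurableEquiv.toLp 2 (Fin m → ℝ)).measurableEmbedding
    (fun z : Vec m => Real.exp (-‖z‖ ^ 2 / 2) * g ‖z‖)

lemma integral_pow_mul_exp (k : ℕ) :
    ∫ y in Ioi (0 : ℝ), y ^ k * Real.exp (-y ^ 2 / 2)
      = (1 / 2 : ℝ) ^ (-((k : ℝ) + 1) / 2) * (1 / 2) * Real.Gamma ((k + 1) / 2) := by
  rw [← integral_rpow_mul_exp_neg_mul_rpow (p := 2) (q := k) (b := 1 / 2) two_pos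
    (by linarith) (by norm_num)]
  refine setIntegral_congr_fun measurableSet_Ioi fun y hy => ?_
  simp only [Real.rpow_natCast, Real.rpow_two]
  congr 2
  ring

/-- The mean of the norm of a standard Gaussian vector. -/
theorem integral_norm_eq_phi {m : ℕ} (hm : 0 < m) :
    ∫ x : Fin m → ℝ, ‖(WithLp.toLp 2 x : Vec m)‖ ∂(gaussPi (Fin m)) = phi m := by
  have : Nonempty (Fin m) := ⟨⟨0, hm⟩⟩
  -- Total mass and mean of the norm are computed by the same polar formula. They share the constant
  -- containing the volume of the ball, which is eliminated between `h0` and `h1` and never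
  -- evaluated.
  have h0 := integral_norm_gaussPi m (fun _ => 1)
  have h1 := integral_norm_gaussPi m (fun r => r)
  rw [integral_fun_norm_addHaar volume (fun r => Real.exp (-r ^ 2 / 2) * 1)] at h0
  rw [integral_fun_norm_addHaar volume (fun r => Real.exp (-r ^ 2 / 2) * r)] at h1
  simp only [finrank_euclideanSpace, Fintype.card_fin, smul_eq_mul, nsmul_eq_mul, mul_one,
    integral_const, probReal_univ] at h0 h1
  have e1 : ∫ y in Ioi (0 : ℝ), y ^ (m - 1) * (Real.exp (-y ^ 2 / 2) * y)
      = ∫ y in Ioi (0 : ℝ), y ^ m * Real.exp (-y ^ 2 / 2) := by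
    refine setIntegral_congr_fun measurableSet_Ioi fun y _ => ?_
    obtain ⟨k, rfl⟩ : ∃ k, m = k + 1 := ⟨m - 1, by omega⟩
    simp only [Nat.add_sub_cancel, pow_succ]
    ring
  rw [integral_pow_mul_exp] at h0
  rw [e1, integral_pow_mul_exp] at h1
  have hm1 : ((m - 1 : ℕ) : ℝ) = m - 1 := by
    rw [Nat.cast_sub hm, Nat.cast_one]
  rw [hm1, sub_add_cancel] at h0
  set K := (√(2 * Real.pi))⁻¹ ^ m * (m * (volume.real (Metric.ball (0 : Vec m) 1))) with hK
  have hG := Real.Gamma_pos_of_pos (show (0 : ℝ) < (m : ℝ) / 2 by positivity)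
  have hp : (1 / 2 : ℝ) ^ (-((m : ℝ) + 1) / 2) = (1 / 2 : ℝ) ^ (-(m : ℝ) / 2) * √2 := by
    rw [show -((m : ℝ) + 1) / 2 = -(m : ℝ) / 2 + -(1 / 2) by ring,
      Real.rpow_add (by norm_num), Real.rpow_neg (by norm_num), ← Real.inv_rpow (by norm_num),
      Real.sqrt_eq_rpow]
    norm_num
  rw [h1, hp, phi, eq_div_iff hG.ne']
  calc _ = (K * ((1 / 2 : ℝ) ^ (-(m : ℝ) / 2) * (1 / 2) * Real.Gamma (m / 2)))
        * (√2 * Real.Gamma ((m + 1) / 2)) := by rw [hK]; ring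
    _ = 1 * (√2 * Real.Gamma ((m + 1) / 2)) := by
        congr 1
        rw [hK]
        linear_combination -h0
    _ = _ := one_mul _

lemma integrable_eval_sq {κ : Type*} [Fintype κ] (k : κ) :
    Integrable (fun x : κ → ℝ => x k ^ 2) (gaussPi κ) :=
  integrable_comp_eval (X := fun _ => ℝ) (μ := fun _ => gaussianReal 0 1) (i := k)
    (f := fun s : ℝ => s ^ 2) (IsGaussian.memLp_two_id.integrable_sq)

lemma integral_eval_sq {κ : Type*} [Fintype κ] (k : κ) :
    ∫ x : κ → ℝ, x k ^ 2 ∂(gaussPi κ) = 1 := by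
  rw [integral_comp_eval (X := fun _ => ℝ) (μ := fun _ => gaussianReal 0 1) (i := k)
    (f := fun s : ℝ => s ^ 2) (by fun_prop)]
  have := variance_id_gaussianReal (μ := 0) (v := 1)
  rw [variance_eq_integral (by fun_prop)] at this
  simpa using this

lemma integrable_norm_sq (m : ℕ) :
    Integrable (fun x : Fin m → ℝ => ‖(WithLp.toLp 2 x : Vec m)‖ ^ 2) (gaussPi (Fin m)) := by
  simp_rw [EuclideanSpace.real_norm_sq_eq]
  exact integrable_finsetSum _ fun k _ => integrable_eval_sq k

lemma integrable_norm_toLp (m : ℕ) :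
    Integrable (fun x : Fin m → ℝ => ‖(WithLp.toLp 2 x : Vec m)‖) (gaussPi (Fin m)) := by
  refine ((integrable_norm_sq m).add (integrable_const 1)).mono' (by fun_prop)
    (Filter.Eventually.of_forall fun x => ?_)
  rw [norm_norm, Pi.add_apply]
  nlinarith [norm_nonneg (WithLp.toLp 2 x : Vec m), sq_nonneg (‖(WithLp.toLp 2 x : Vec m)‖ - 1)]

lemma integral_norm_sq (m : ℕ) :
    ∫ x : Fin m → ℝ, ‖(WithLp.toLp 2 x : Vec m)‖ ^ 2 ∂(gaussPi (Fin m)) = m := by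
  simp_rw [EuclideanSpace.real_norm_sq_eq]
  rw [integral_finsetSum _ fun k _ => integrable_eval_sq k]
  simp [integral_eval_sq]

/-- The norm of a standard Gaussian vector has bounded mean deviation. -/
theorem integral_abs_norm_sub_phi_le {m : ℕ} (hm : 0 < m) :
    ∫ x : Fin m → ℝ, |‖(WithLp.toLp 2 x : Vec m)‖ - phi m| ∂(gaussPi (Fin m)) ≤ 1 := by
  have i1 := integrable_norm_toLp m
  have i2 := integrable_norm_sq m
  -- This is `|a| ≤ (1 + a²) / 2`, which bounds the mean deviation through the variance.
  have h : ∀ x : Fin m → ℝ, |‖(WithLp.toLp 2 x : Vec m)‖ - phi m|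
      ≤ (1 + (‖(WithLp.toLp 2 x : Vec m)‖ ^ 2 - 2 * phi m * ‖(WithLp.toLp 2 x : Vec m)‖
        + phi m ^ 2)) / 2 := fun x => by
    have e := sq_abs (‖(WithLp.toLp 2 x : Vec m)‖ - phi m)
    nlinarith [sq_nonneg (|‖(WithLp.toLp 2 x : Vec m)‖ - phi m| - 1)]
  have j1 : Integrable (fun x : Fin m → ℝ => ‖(WithLp.toLp 2 x : Vec m)‖ ^ 2
      - 2 * phi m * ‖(WithLp.toLp 2 x : Vec m)‖) (gaussPi (Fin m)) :=
    i2.sub (i1.const_mul (2 * phi m))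
  have j2 : Integrable (fun x : Fin m → ℝ => ‖(WithLp.toLp 2 x : Vec m)‖ ^ 2
      - 2 * phi m * ‖(WithLp.toLp 2 x : Vec m)‖ + phi m ^ 2) (gaussPi (Fin m)) :=
    j1.add (integrable_const _)
  have e : ∫ x : Fin m → ℝ, (1 + (‖(WithLp.toLp 2 x : Vec m)‖ ^ 2
      - 2 * phi m * ‖(WithLp.toLp 2 x : Vec m)‖ + phi m ^ 2)) / 2 ∂(gaussPi (Fin m))
      = (1 + (m - 2 * phi m * phi m + phi m ^ 2)) / 2 := by
    rw [integral_div, integral_add (integrable_const _) j2, integral_add j1 (integrable_const _),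
      integral_sub i2 (i1.const_mul _), integral_const_mul, integral_norm_eq_phi hm,
      integral_norm_sq]
    simp
  refine (integral_mono (i1.sub (integrable_const _)).abs
    (((integrable_const _).add j2).div_const _) h).trans ?_
  refine e.le.trans ?_
  have := sub_one_le_phi_sq (show (0 : ℝ) < m by exact_mod_cast hm)
  nlinarith

end ChiMean

/-! ### Tail bound for finite families of vectors -/

lemma measurePreserving_toLp_stdGaussian (n : ℕ) :
    MeasurePreserving (WithLp.toLp 2 : (Fin n → ℝ) → Vec n) (gaussPi (Fin n))
      (stdGaussian (Vec n)) :=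
  ⟨by fun_prop, map_pi_eq_stdGaussian⟩

lemma measurePreserving_inr (m n : ℕ) :
    MeasurePreserving (fun y : Fin m ⊕ Fin n → ℝ => (WithLp.toLp 2 (fun k => y (Sum.inr k)) : Vec n))
      (gaussPi (Fin m ⊕ Fin n)) (stdGaussian (Vec n)) :=
  (measurePreserving_toLp_stdGaussian n).comp
    (measurePreserving_snd.comp measurePreserving_gaussPi_sum)

lemma measurePreserving_inl (m n : ℕ) :
    MeasurePreserving (fun y : Fin m ⊕ Fin n → ℝ => fun k => y (Sum.inl k))
      (gaussPi (Fin m ⊕ Fin n)) (gaussPi (Fin m)) :=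
  measurePreserving_fst.comp measurePreserving_gaussPi_sum

section Tail

variable {m n : ℕ} {ι : Type*}

/-- After comparison the vectors `w` share a single `h`, so centering by `b ‖w‖` leaves at most `L
|‖h‖ - b|`, plus `√c` from smoothing the norm. -/
lemma gordonFun_split_le {s c b L : ℝ} (hs : s = 1 ∨ s = -1) (hc : 0 < c) (w : ι → Vec n)
    (hw : ∀ i, ‖w i‖ ≤ L) (h : Vec m) (t : ι → ℝ) (i : ι) :
    gordonFun m s c b w i (fun i => (‖w i‖ • h, t i)) ≤ √c + L * |‖h‖ - b| + t i := by
  have h1 := norm_le_smoothNorm hc (‖w i‖ • h)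
  have h2 := smoothNorm_le hc (‖w i‖ • h)
  rw [norm_smul, norm_norm] at h1 h2
  have h3 : ‖w i‖ * |‖h‖ - b| ≤ L * |‖h‖ - b| := by gcongr; exact hw i
  have h4 := mul_le_mul_of_nonneg_left (le_abs_self (‖h‖ - b)) (norm_nonneg (w i))
  have h5 := mul_le_mul_of_nonneg_left (neg_abs_le (‖h‖ - b)) (norm_nonneg (w i))
  simp only [gordonFun]
  rcases hs with rfl | rfl <;> linarith

variable [Fintype ι] [Nonempty ι]

/-- The four terms are the error of the soft maximum, the error of the smooth norm, `L E|‖h‖ - φ(m)|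
≤ L`, and the mean of a majorant `U` of the linear forms. -/
lemma integral_gordonLse_le {s c β L : ℝ} (hs : s = 1 ∨ s = -1) (hc : 0 < c) (hβ : 0 < β)
    (hm : 0 < m) (w : ι → Vec n) (hL : 0 ≤ L) (hw : ∀ i, ‖w i‖ ≤ L) {U : Vec n → ℝ}
    (hU : Integrable U (stdGaussian (Vec n))) (hwU : ∀ g i, inner ℝ g (w i) ≤ U g) :
    ∫ x, gordonLse m β s c (phi m) w (matrixDirCLM m w x) ∂(gaussPi (Fin m × Fin n))
      ≤ Real.log (Fintype.card ι) / β + √c + L + ∫ g, U g ∂(stdGaussian (Vec n)) := by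
  simp only [matrixDirCLM_apply]
  refine (integral_gordonLse_matVec_le w hβ (by rcases hs with rfl | rfl <;> norm_num) hc
    (phi m)).trans ?_
  have iU := (measurePreserving_inr m n).integrable_comp_of_integrable hU
  have iN0 : Integrable (fun x : Fin m → ℝ => |‖(WithLp.toLp 2 x : Vec m)‖ - phi m|)
      (gaussPi (Fin m)) := ((integrable_norm_toLp m).sub (integrable_const _)).abs
  have iN := (measurePreserving_inl m n).integrable_comp_of_integrable iN0
  have iK : Integrable (fun _ : Fin m ⊕ Fin n → ℝ => Real.log (Fintype.card ι) / β + √c)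
      (gaussPi (Fin m ⊕ Fin n)) := integrable_const _
  have iLN := iN.const_mul L
  have iF := (boundedSecondOrder_gordonLse (m := m) w (s := s) hβ hc
    (phi m)).secondOrder.integrable (splitDir m w) (c := fun _ => 1) (by simp)
  simp only [one_mul, sum_smul_splitDir] at iF
  refine (integral_mono iF ((iK.add iLN).add iU) fun y => ?_).trans (le_of_eq_of_le
    ((integral_add (iK.add iLN) iU).trans (congrArg₂ _ (integral_add iK iLN) rfl)) ?_)
  · refine (lse_le hβ _ fun i => (gordonFun_split_le hs hc w hw _ _ i).trans
      (add_le_add le_rfl (hwU _ i))).trans (le_of_eq ?_)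
    simp only [Pi.add_apply, Function.comp_apply]
    ring
  · rw [integral_const_mul]
    have e1 : ∫ y, ((fun x : Fin m → ℝ => |‖(WithLp.toLp 2 x : Vec m)‖ - phi m|)
        ∘ fun y : Fin m ⊕ Fin n → ℝ => fun k => y (Sum.inl k)) y ∂(gaussPi (Fin m ⊕ Fin n))
        = ∫ x, |‖(WithLp.toLp 2 x : Vec m)‖ - phi m| ∂(gaussPi (Fin m)) :=
      integral_gaussPi_inl (f := fun x : Fin m → ℝ => |‖(WithLp.toLp 2 x : Vec m)‖ - phi m|)
        (by fun_prop)
    have e2 : ∫ y, (U ∘ fun y : Fin m ⊕ Fin n → ℝ =>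
        (WithLp.toLp 2 (fun k => y (Sum.inr k)) : Vec n)) y ∂(gaussPi (Fin m ⊕ Fin n))
        = ∫ g, U g ∂(stdGaussian (Vec n)) := by
      rw [← (measurePreserving_inr m n).map_eq, integral_map
        (measurePreserving_inr m n).aemeasurable]
      · rfl
      · rw [(measurePreserving_inr m n).map_eq]; exact hU.1
    rw [e1, e2]
    have := mul_le_mul_of_nonneg_left (integral_abs_norm_sub_phi_le hm) hL
    simp only [integral_const, probReal_univ, one_smul]
    linarith

/-- Gordon's escape-type tail bound over a finite family of vectors. -/
theorem measure_deviation_le (hm : 0 < m) (w : ι → Vec n) (hw : ∀ i, ‖w i‖ ≤ 2) {U : Vec n → ℝ}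
    (hU : Integrable U (stdGaussian (Vec n))) (hwU : ∀ g i, inner ℝ g (w i) ≤ U g) {M : ℝ}
    (hM : ∫ g, U g ∂(stdGaussian (Vec n)) ≤ M) {s : ℝ} (hs : s = 1 ∨ s = -1) {η : ℝ}
    (hη : 3 ≤ η) :
    (gaussPi (Fin m × Fin n)).real
      {x | ∃ i, M + 2 * η < s * (‖matVec x (w i)‖ - phi m * ‖w i‖)} ≤ Real.exp (-η ^ 2 / 8) := by
  have hs2 : s ^ 2 = 1 := by rcases hs with rfl | rfl <;> norm_num
  -- Smoothing then costs `√c = 1/4`, and the choice of `β` below keeps the soft maximum within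
  -- `1/2` of the maximum.
  have hc : (0 : ℝ) < 1 / 16 := by norm_num
  have hsc : √(1 / 16 : ℝ) = 1 / 4 := by
    rw [show (1 / 16 : ℝ) = (1 / 4) ^ 2 by norm_num]
    exact Real.sqrt_sq (by norm_num)
  set β := 2 * Real.log (Fintype.card ι) + 1 with hβdef
  have hβ : 0 < β := by positivity
  have hlogβ : Real.log (Fintype.card ι) / β ≤ 1 / 2 := by
    rw [div_le_iff₀ hβ]; linarith
  have hmean := integral_gordonLse_le (m := m) hs hc hβ hm w zero_le_two hw hU hwU
  rw [hsc] at hmean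
  -- The mean excess is `1/2 + 1/4 + 2 = 11/4`. With `t = 2η - 3` the level is `M + 2η - 1/4`, the
  -- final `1/4` covering the smooth norm when `s = -1`.
  have key := ((boundedSecondOrder_gordonLse (m := m) w (s := s) hβ hc (phi m)).comp_clm
    (matrixDirCLM m w)).measure_ge_le (gradientBound_gordonLse w hs2 hc (phi m) zero_le_two hw)
    two_pos (M := M + 11 / 4) (t := 2 * η - 3) (by linarith) (by linarith)
  refine (measureReal_mono ?_).trans (key.trans ?_)
  · rintro x ⟨i, hi⟩
    have h1 := le_lse (f := gordonFun m s (1 / 16) (phi m) w) hβ (matrixDirCLM m w x) i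
    refine le_trans ?_ h1
    rw [matrixDirCLM_apply]
    simp only [gordonFun, add_zero]
    have h2 := norm_le_smoothNorm hc (matVec x (w i))
    have h3 := smoothNorm_le hc (matVec x (w i))
    rw [hsc] at h3
    rcases hs with rfl | rfl <;> linarith
  · rw [Real.exp_le_exp]
    -- Here `η ≥ 3` is used: `2η - 3 ≥ η`. The exponent is over `2 L² = 8`.
    have : η ^ 2 ≤ (2 * η - 3) ^ 2 := by nlinarith
    linarith

end Tail

/-! ### Support functions and Gaussian width -/

section Width

variable {n : ℕ} {K : Set (Vec n)}

/-- The support function of a set. -/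
def supportFun (K : Set (Vec n)) (g : Vec n) : ℝ := sSup ((fun z : Vec n => inner ℝ g z) '' K)

lemma bddAbove_inner_image (hK : K ⊆ Metric.closedBall 0 1) (g : Vec n) :
    BddAbove ((fun z : Vec n => inner ℝ g z) '' K) := by
  refine ⟨‖g‖, ?_⟩
  rintro _ ⟨z, hz, rfl⟩
  have h1 : ‖z‖ ≤ 1 := by simpa using hK hz
  exact (real_inner_le_norm g z).trans (mul_le_of_le_one_right (norm_nonneg _) h1)

lemma inner_le_supportFun (hK : K ⊆ Metric.closedBall 0 1) (g : Vec n) {z : Vec n} (hz : z ∈ K) :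
    inner ℝ g z ≤ supportFun K g :=
  le_csSup (bddAbove_inner_image hK g) (mem_image_of_mem _ hz)

lemma supportFun_nonneg (hK : K ⊆ Metric.closedBall 0 1) (h0 : (0 : Vec n) ∈ K) (g : Vec n) :
    0 ≤ supportFun K g := by
  simpa using inner_le_supportFun hK g h0

lemma lipschitzWith_supportFun (hK : K ⊆ Metric.closedBall 0 1) (h0 : (0 : Vec n) ∈ K) :
    LipschitzWith 1 (supportFun K) := by
  refine LipschitzWith.of_le_add_mul 1 fun g g' => ?_
  refine csSup_le (Nonempty.image _ ⟨0, h0⟩) ?_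
  rintro _ ⟨z, hz, rfl⟩
  have h1 : ‖z‖ ≤ 1 := by simpa using hK hz
  have h2 := inner_le_supportFun hK g' hz
  have h3 := (real_inner_le_norm (g - g') z).trans (mul_le_of_le_one_right (norm_nonneg _) h1)
  rw [inner_sub_left] at h3
  rw [dist_eq_norm, NNReal.coe_one, one_mul]
  linarith

lemma integrable_supportFun (hK : K ⊆ Metric.closedBall 0 1) (h0 : (0 : Vec n) ∈ K) :
    Integrable (supportFun K) (stdGaussian (Vec n)) := by
  have hid : Integrable (fun g : Vec n => g) (stdGaussian (Vec n)) := IsGaussian.integrable_fun_id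
  refine hid.norm.mono' (lipschitzWith_supportFun hK h0).continuous.aestronglyMeasurable
    (Filter.Eventually.of_forall fun g => ?_)
  rw [Real.norm_of_nonneg (supportFun_nonneg hK h0 g)]
  refine csSup_le (Nonempty.image _ ⟨0, h0⟩) ?_
  rintro _ ⟨z, hz, rfl⟩
  have h1 : ‖z‖ ≤ 1 := by simpa using hK hz
  exact (real_inner_le_norm g z).trans (mul_le_of_le_one_right (norm_nonneg _) h1)

lemma measurePreserving_neg_stdGaussian (n : ℕ) :
    MeasurePreserving (fun g : Vec n => -g) (stdGaussian (Vec n)) (stdGaussian (Vec n)) :=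
  ⟨by fun_prop, stdGaussian_map (LinearIsometryEquiv.neg ℝ)⟩

lemma integrable_supportFun_smul (hK : K ⊆ Metric.closedBall 0 1) (h0 : (0 : Vec n) ∈ K) {t : ℝ}
    (ht : t = 1 ∨ t = -1) :
    Integrable (fun g => supportFun K (t • g)) (stdGaussian (Vec n)) := by
  rcases ht with rfl | rfl
  · simpa using integrable_supportFun hK h0
  · simp only [neg_smul, one_smul]
    exact (measurePreserving_neg_stdGaussian n).integrable_comp_of_integrable
      (integrable_supportFun hK h0)

lemma integral_supportFun_smul (K : Set (Vec n)) {t : ℝ} (ht : t = 1 ∨ t = -1) :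
    ∫ g, supportFun K (t • g) ∂(stdGaussian (Vec n)) = gaussianWidth K := by
  rcases ht with rfl | rfl
  · simp only [one_smul]; rfl
  · simp only [neg_smul, one_smul]
    exact (measurePreserving_neg_stdGaussian n).integral_comp
      (MeasurableEquiv.neg (Vec n)).measurableEmbedding (supportFun K)

lemma gaussianWidth_nonneg (hK : K ⊆ Metric.closedBall 0 1) (h0 : (0 : Vec n) ∈ K) :
    0 ≤ gaussianWidth K :=
  integral_nonneg fun g => supportFun_nonneg hK h0 g

end Width

/-! ### The near-isometry event -/

section GoodEvent

variable {m n : ℕ}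

lemma continuous_matVec (u : Vec n) : Continuous fun x : Fin m × Fin n → ℝ => matVec x u := by
  have h := fun x : Fin m × Fin n → ℝ => matrixDirCLM_apply (m := m) (fun _ : Unit => u) x
  have e : (fun x : Fin m × Fin n → ℝ => matVec x u)
      = fun x => (matrixDirCLM m (fun _ : Unit => u) x ()).1 := by
    funext x; rw [h]
  rw [e]
  fun_prop

lemma continuous_matVec_right (x : Fin m × Fin n → ℝ) : Continuous (matVec x) :=
  (Matrix.toEuclideanLin (Matrix.of fun r k => x (r, k))).continuous_of_finiteDimensional

/-- The tail bound over a countable family of vectors. -/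
theorem measure_deviation_countable_le {ι : Type*} [Countable ι] (hm : 0 < m) (w : ι → Vec n)
    (hw : ∀ i, ‖w i‖ ≤ 2) {U : Vec n → ℝ} (hU : Integrable U (stdGaussian (Vec n)))
    (hwU : ∀ g i, inner ℝ g (w i) ≤ U g) {M : ℝ}
    (hM : ∫ g, U g ∂(stdGaussian (Vec n)) ≤ M) {s : ℝ} (hs : s = 1 ∨ s = -1) {η : ℝ}
    (hη : 3 ≤ η) :
    gaussPi (Fin m × Fin n) {x | ∃ i, M + 2 * η < s * (‖matVec x (w i)‖ - phi m * ‖w i‖)}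
      ≤ ENNReal.ofReal (Real.exp (-η ^ 2 / 8)) := by
  classical
  set B : Finset ι → Set (Fin m × Fin n → ℝ) := fun S =>
    {x | ∃ i ∈ S, M + 2 * η < s * (‖matVec x (w i)‖ - phi m * ‖w i‖)} with hB
  -- The finite bound does not depend on the number of vectors, so continuity from below extends it
  -- to countable families.
  have hdir : Directed (· ⊆ ·) B := by
    refine directed_of_isDirected_le fun S T hST x => ?_
    rintro ⟨i, hi, h⟩
    exact ⟨i, hST hi, h⟩
  have hun : {x | ∃ i, M + 2 * η < s * (‖matVec x (w i)‖ - phi m * ‖w i‖)} = ⋃ S, B S := by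
    ext x
    simp only [mem_ofPred_eq, mem_iUnion, hB]
    constructor
    · rintro ⟨i, h⟩
      exact ⟨{i}, i, by simp, h⟩
    · rintro ⟨S, i, -, h⟩
      exact ⟨i, h⟩
  rw [hun, hdir.measure_iUnion]
  refine iSup_le fun S => ?_
  rcases S.eq_empty_or_nonempty with rfl | hS
  · simp [hB]
  · have : Nonempty S := hS.to_subtype
    have h := measure_deviation_le hm (fun i : S => w i) (fun i => hw i) hU (fun g i => hwU g i)
      hM hs hη
    rw [← ofReal_measureReal]
    refine ENNReal.ofReal_le_ofReal (le_trans (le_of_eq ?_) h)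
    congr 1
    ext x
    simp [hB]

/-- Uniform near-isometry of a matrix on sums and differences of elements of `K` and of
`insert v K`. -/
def nearIsometrySet (m : ℕ) (K : Set (Vec n)) (v : Vec n) (δ : ℝ) : Set (Fin m × Fin n → ℝ) :=
  {x | ∀ u ∈ K, ∀ u' ∈ insert v K, ∀ t : ℝ, t = 1 ∨ t = -1 →
    |‖matVec x (u + t • u')‖ - phi m * ‖u + t • u'‖| ≤ δ}

lemma isClosed_nearIsometrySet (K : Set (Vec n)) (v : Vec n) (δ : ℝ) :
    IsClosed (nearIsometrySet m K v δ) := by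
  simp only [nearIsometrySet, ofPred_forall]
  refine isClosed_iInter fun u => isClosed_iInter fun _ => isClosed_iInter fun u' =>
    isClosed_iInter fun _ => isClosed_iInter fun t => isClosed_iInter fun _ => ?_
  have := continuous_matVec (m := m) (u + t • u')
  exact isClosed_le (by fun_prop) continuous_const

lemma norm_add_smul_le_two {u v : Vec n} (hu : ‖u‖ ≤ 1) (hv : ‖v‖ ≤ 1) {t : ℝ}
    (ht : t = 1 ∨ t = -1) : ‖u + t • v‖ ≤ 2 := by
  have : ‖t • v‖ ≤ 1 := by rcases ht with rfl | rfl <;> simpa using hv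
  linarith [norm_add_le u (t • v)]

theorem measure_compl_nearIsometrySet_le (hm : 0 < m) {K : Set (Vec n)}
    (hK : K ⊆ Metric.closedBall 0 1) (h0 : (0 : Vec n) ∈ K) {v : Vec n} (hv : ‖v‖ ≤ 1) {η : ℝ}
    (hη : 3 ≤ η) :
    gaussPi (Fin m × Fin n) (nearIsometrySet m K v (2 * gaussianWidth K + 2 * η))ᶜ
      ≤ ENNReal.ofReal (8 * Real.exp (-η ^ 2 / 8)) := by
  set ω := gaussianWidth K with hω
  have hK1 : ∀ u ∈ K, ‖u‖ ≤ 1 := fun u hu => by simpa using hK hu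
  have : Nonempty K := ⟨⟨0, h0⟩⟩
  -- Both sides of the near isometry are continuous in the vectors, so checking a countable dense
  -- subset suffices.
  set d : ℕ → K := TopologicalSpace.denseSeq K with hd
  have hdense : DenseRange d := TopologicalSpace.denseRange_denseSeq K
  set B₁ : ℝ → ℝ → Set (Fin m × Fin n → ℝ) := fun s t => {x | ∃ i : ℕ × ℕ, 2 * ω + 2 * η <
    s * (‖matVec x (d i.1 + t • (d i.2 : Vec n))‖ - phi m * ‖(d i.1 : Vec n) + t • (d i.2 : Vec n)‖)}
    with hB₁
  set B₂ : ℝ → ℝ → Set (Fin m × Fin n → ℝ) := fun s t => {x | ∃ i : ℕ, 2 * ω + 2 * η <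
    s * (‖matVec x (d i + t • v)‖ - phi m * ‖(d i : Vec n) + t • v‖)} with hB₂
  have hb₁ : ∀ s t : ℝ, s = 1 ∨ s = -1 → t = 1 ∨ t = -1 → gaussPi (Fin m × Fin n) (B₁ s t)
      ≤ ENNReal.ofReal (Real.exp (-η ^ 2 / 8)) := fun s t hs ht => by
    have i1 := integrable_supportFun hK h0
    have i2 := integrable_supportFun_smul hK h0 ht
    refine measure_deviation_countable_le hm
      (fun i : ℕ × ℕ => (d i.1 : Vec n) + t • (d i.2 : Vec n))
      (fun i => norm_add_smul_le_two (hK1 _ (d i.1).2) (hK1 _ (d i.2).2) ht) (i1.add i2)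
      (fun g i => ?_) ?_ hs hη
    · rw [inner_add_right, inner_smul_right, ← real_inner_smul_left]
      exact add_le_add (inner_le_supportFun hK _ (d i.1).2) (inner_le_supportFun hK _ (d i.2).2)
    · refine le_of_eq ((integral_add i1 i2).trans ?_)
      rw [integral_supportFun_smul K ht, hω]
      change gaussianWidth K + _ = _
      ring
  have hb₂ : ∀ s t : ℝ, s = 1 ∨ s = -1 → t = 1 ∨ t = -1 → gaussPi (Fin m × Fin n) (B₂ s t)
      ≤ ENNReal.ofReal (Real.exp (-η ^ 2 / 8)) := fun s t hs ht => by
    have i1 := integrable_supportFun hK h0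
    have i2 : Integrable (fun g : Vec n => innerSL ℝ (t • v) g) (stdGaussian (Vec n)) :=
      (innerSL ℝ (t • v)).integrable_comp IsGaussian.integrable_fun_id
    refine measure_deviation_countable_le hm (fun i : ℕ => (d i : Vec n) + t • v)
      (fun i => norm_add_smul_le_two (hK1 _ (d i).2) hv ht) (i1.add i2)
      (fun g i => ?_) ?_ hs hη
    · rw [inner_add_right, real_inner_comm (t • v) g]
      exact add_le_add (inner_le_supportFun hK _ (d i).2) le_rfl
    · refine le_of_eq_of_le (integral_add i1 i2) ?_
      -- A fixed vector contributes a centered linear form, so these sums have width at most `ω`,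
      -- which is weakened to the common `2 ω`.
      rw [integral_strongDual_stdGaussian, add_zero]
      change gaussianWidth K ≤ _
      have := gaussianWidth_nonneg hK h0
      linarith
  have hsub : (nearIsometrySet m K v (2 * ω + 2 * η))ᶜ ⊆
      ((B₁ 1 1 ∪ B₁ 1 (-1)) ∪ (B₁ (-1) 1 ∪ B₁ (-1) (-1))) ∪
      ((B₂ 1 1 ∪ B₂ 1 (-1)) ∪ (B₂ (-1) 1 ∪ B₂ (-1) (-1))) := by
    rw [compl_subset_comm]
    intro x hx
    simp only [mem_compl_iff, mem_union, not_or] at hx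
    obtain ⟨⟨⟨a1, a2⟩, a3, a4⟩, ⟨a5, a6⟩, a7, a8⟩ := hx
    simp only [hB₁, hB₂, mem_ofPred_eq, not_exists, not_lt, one_mul] at a1 a2 a3 a4 a5 a6 a7 a8
    have hx := continuous_matVec_right x
    intro u hu u' hu' t ht
    rcases mem_insert_iff.1 hu' with rfl | hu'
    · have := hdense.induction_on (p := fun a : K =>
        |‖matVec x (a + t • u')‖ - phi m * ‖(a : Vec n) + t • u'‖| ≤ 2 * ω + 2 * η) ⟨u, hu⟩
        (isClosed_le (by fun_prop) continuous_const) (fun i => by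
          rw [abs_le']
          rcases ht with rfl | rfl
          · exact ⟨a5 i, by linarith [a7 i]⟩
          · exact ⟨a6 i, by linarith [a8 i]⟩)
      exact this
    · have := hdense.induction_on₂ (p := fun a b : K =>
        |‖matVec x (a + t • (b : Vec n))‖ - phi m * ‖(a : Vec n) + t • (b : Vec n)‖|
          ≤ 2 * ω + 2 * η)
        (isClosed_le (by fun_prop) continuous_const) (fun i j => by
          rw [abs_le']
          rcases ht with rfl | rfl
          · exact ⟨a1 (i, j), by linarith [a3 (i, j)]⟩
          · exact ⟨a2 (i, j), by linarith [a4 (i, j)]⟩) ⟨u, hu⟩ ⟨u', hu'⟩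
      exact this
  have p1 : (1 : ℝ) = 1 ∨ (1 : ℝ) = -1 := Or.inl rfl
  have p2 : (-1 : ℝ) = 1 ∨ (-1 : ℝ) = -1 := Or.inr rfl
  set q := ENNReal.ofReal (Real.exp (-η ^ 2 / 8)) with hq
  have hun : ∀ {S T : Set (Fin m × Fin n → ℝ)} {a b : ENNReal}, gaussPi (Fin m × Fin n) S ≤ a →
      gaussPi (Fin m × Fin n) T ≤ b → gaussPi (Fin m × Fin n) (S ∪ T) ≤ a + b := fun hS hT =>
    (measure_union_le _ _).trans (add_le_add hS hT)
  refine (measure_mono hsub).trans ((hun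
    (hun (hun (hb₁ _ _ p1 p1) (hb₁ _ _ p1 p2)) (hun (hb₁ _ _ p2 p1) (hb₁ _ _ p2 p2)))
    (hun (hun (hb₂ _ _ p1 p1) (hb₂ _ _ p1 p2)) (hun (hb₂ _ _ p2 p1) (hb₂ _ _ p2 p2)))).trans
    (le_of_eq ?_))
  -- The constant `8` counts two signs of the deviation, sum or difference, and second vector in `K`
  -- or equal to `v`.
  rw [ENNReal.ofReal_mul (by norm_num), ← hq]
  norm_num
  ring

lemma map_entries_eq {Ω : Type*} [MeasurableSpace Ω] {P : Measure Ω} [IsProbabilityMeasure P]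
    {A : Ω → Matrix (Fin m) (Fin n) ℝ} (hA : IsGaussianMap P A) :
    AEMeasurable (fun ω (k : Fin m × Fin n) => A ω k.1 k.2) P ∧
      P.map (fun ω (k : Fin m × Fin n) => A ω k.1 k.2) = gaussPi (Fin m × Fin n) := by
  have hm : ∀ k : Fin m × Fin n, AEMeasurable (fun ω => A ω k.1 k.2) P := fun k =>
    (hA.1 k.1 k.2).aemeasurable
  refine ⟨aemeasurable_pi_lambda _ hm, ?_⟩
  rw [(iIndepFun_iff_map_fun_eq_pi_map hm).1 hA.2]
  congr 1
  funext k
  exact (hA.1 k.1 k.2).map_eq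

/-- With high probability a Gaussian map is nearly isometric on sums and differences. -/
theorem exists_nearIsometry_event {Ω : Type*} [MeasurableSpace Ω] (P : Measure Ω)
    [IsProbabilityMeasure P] {A : Ω → Matrix (Fin m) (Fin n) ℝ} (hA : IsGaussianMap P A)
    (hm : 0 < m) {K : Set (Vec n)} (hK : K ⊆ Metric.closedBall 0 1) (h0 : (0 : Vec n) ∈ K)
    {v : Vec n} (hv : ‖v‖ ≤ 1) (η : ℝ) (hη : 0 ≤ η) :
    ∃ E : Set Ω, MeasurableSet E ∧ 1 - 8 * Real.exp (-η ^ 2 / 8) ≤ P.real E ∧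
      ∀ ω ∈ E, ∀ u ∈ K, ∀ u' ∈ insert v K, ∀ t : ℝ, t = 1 ∨ t = -1 →
        |‖Matrix.toEuclideanLin (A ω) (u + t • u')‖ - phi m * ‖u + t • u'‖|
          ≤ 2 * gaussianWidth K + 2 * η := by
  -- For `η < 3` the claimed probability is not positive, so the empty event works.
  rcases lt_or_ge η 3 with hη3 | hη3
  · refine ⟨∅, MeasurableSet.empty, ?_, by simp⟩
    rw [measureReal_empty, sub_nonpos]
    have h1 : Real.exp 2 ≤ 8 := by
      have := Real.exp_one_lt_d9
      rw [show (2 : ℝ) = 1 + 1 by norm_num, Real.exp_add]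
      nlinarith [Real.exp_pos 1]
    have h2 : Real.exp (-2) ≤ Real.exp (-η ^ 2 / 8) := by
      rw [Real.exp_le_exp]; nlinarith
    have h3 : Real.exp 2 * Real.exp (-2) = 1 := by rw [← Real.exp_add]; norm_num
    nlinarith [Real.exp_pos 2, Real.exp_pos (-2)]
  · obtain ⟨hX, hmap⟩ := map_entries_eq hA
    set X : Ω → Fin m × Fin n → ℝ := fun ω k => A ω k.1 k.2 with hXdef
    set G := nearIsometrySet m K v (2 * gaussianWidth K + 2 * η) with hG
    have hbad : P (X ⁻¹' Gᶜ) ≤ ENNReal.ofReal (8 * Real.exp (-η ^ 2 / 8)) := by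
      rw [← Measure.map_apply_of_aemeasurable hX
        (isClosed_nearIsometrySet K v _).isOpen_compl.measurableSet, hmap]
      exact measure_compl_nearIsometrySet_le hm hK h0 hv hη3
    -- The entries are only almost everywhere measurable, so the bad set is replaced by a measurable
    -- hull of equal measure.
    refine ⟨(toMeasurable P (X ⁻¹' Gᶜ))ᶜ, (measurableSet_toMeasurable _ _).compl, ?_, ?_⟩
    · rw [probReal_compl_eq_one_sub (measurableSet_toMeasurable _ _), measureReal_def,
        measure_toMeasurable]
      have := ENNReal.toReal_le_of_le_ofReal (by positivity) hbad
      linarith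
    · intro ω hω
      have : X ω ∈ G := by
        by_contra h
        exact hω (subset_toMeasurable P _ h)
      exact this

end GoodEvent

/-! ### Tangent cones and homogeneity -/

section Cones

variable {n : ℕ} {f : Vec n → ℝ} {x : Vec n}

lemma descentSet_subset_tangentCone (f : Vec n → ℝ) (x : Vec n) :
    descentSet f x ⊆ tangentCone f x := fun _ hh => mem_sInter.2 fun _ hC => hC.2 hh

lemma smul_mem_tangentCone {h : Vec n} (hh : h ∈ tangentCone f x) {t : ℝ} (ht : 0 ≤ t) :
    t • h ∈ tangentCone f x :=
  mem_sInter.2 fun C hC => hC.1.2 t ht h (mem_sInter.1 hh C hC)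

lemma zero_mem_tangentCone (f : Vec n → ℝ) (x : Vec n) : (0 : Vec n) ∈ tangentCone f x :=
  descentSet_subset_tangentCone f x (by
    change f (x + 0) ≤ f x
    rw [add_zero])

lemma sub_mem_tangentCone {z : Vec n} (h : f z ≤ f x) : z - x ∈ tangentCone f x :=
  descentSet_subset_tangentCone f x (by
    change f (x + (z - x)) ≤ f x
    rwa [add_sub_cancel])

lemma AbsHomogeneous.descentSet_smul_subset (hf : AbsHomogeneous f) {c : ℝ} (hc : 0 < c)
    {C : Set (Vec n)} (hC : IsClosedCone C) (h : descentSet f x ⊆ C) :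
    descentSet f (c • x) ⊆ C := by
  intro u hu
  have hu' : c⁻¹ • u ∈ descentSet f x := by
    change f (x + c⁻¹ • u) ≤ f x
    have h1 : f (c • x + u) ≤ f (c • x) := hu
    have h2 : x + c⁻¹ • u = c⁻¹ • (c • x + u) := by
      rw [smul_add, smul_smul, inv_mul_cancel₀ hc.ne', one_smul]
    rw [h2, hf]
    rw [hf c x, abs_of_pos hc] at h1
    rw [abs_of_pos (inv_pos.2 hc), inv_mul_le_iff₀ hc]
    exact h1
  have := hC.2 c hc.le _ (h hu')
  rwa [smul_smul, mul_inv_cancel₀ hc.ne', one_smul] at this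

/-- The tangent cones of an absolutely homogeneous function are constant along rays. -/
theorem AbsHomogeneous.tangentCone_smul (hf : AbsHomogeneous f) {c : ℝ} (hc : 0 < c)
    (x : Vec n) : tangentCone f (c • x) = tangentCone f x := by
  unfold tangentCone
  congr 1
  ext C
  refine ⟨fun h => ⟨h.1, ?_⟩, fun h => ⟨h.1, hf.descentSet_smul_subset hc h.1 h.2⟩⟩
  have := hf.descentSet_smul_subset (inv_pos.2 hc) h.1 h.2
  rwa [smul_smul, inv_mul_cancel₀ hc.ne', one_smul] at this

lemma AbsHomogeneous.phaseTransition_smul (hf : AbsHomogeneous f) {c : ℝ} (hc : 0 < c)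
    (x : Vec n) (η : ℝ) : phaseTransition f (c • x) η = phaseTransition f x η := by
  rw [phaseTransition, phaseTransition, hf.tangentCone_smul hc]

lemma AbsHomogeneous.map_zero (hf : AbsHomogeneous f) : f 0 = 0 := by
  simpa using hf 0 0

lemma AbsHomogeneous.pos_of_ne_zero (hf : AbsHomogeneous f) (hadd : ∀ u v, f (u + v) ≤ f u + f v)
    (hdef : ∀ v, f v = 0 → v = 0) (hx : x ≠ 0) : 0 < f x := by
  have h1 := hadd x (-x)
  have h2 : f (-x) = f x := by simpa using hf (-1) x
  rw [add_neg_cancel, hf.map_zero, h2] at h1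
  exact lt_of_le_of_ne (by linarith) fun h => hx (hdef x h.symm)

end Cones

/-! ### Restricted bound for `I - μ A*A` -/

section RestrictedBound

/-- Here `p`, `q` stand for `‖u + v‖`, `‖u - v‖`, and `P`, `Q` for the rescaled norms of their
images. The main case is `p² - (p - 2r)² + (q + 2r)² - q² = 4 r (p + q)`, and `p² + q² ≤ 4` gives `p
+ q ≤ √8`, the source of `√8` in the rate. -/
lemma sq_sub_sq_le {p q P Q r : ℝ} (hp : 0 ≤ p) (hq : 0 ≤ q) (hQ : 0 ≤ Q)
    (hr : 0 ≤ r) (hr1 : √8 * r ≤ 1) (hpq : p ^ 2 + q ^ 2 ≤ 4) (hPp : p - 2 * r ≤ P)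
    (hQq : Q ≤ q + 2 * r) : p ^ 2 - q ^ 2 - (P ^ 2 - Q ^ 2) ≤ 4 * (√8 * r) := by
  have h8' : 2.8 ≤ √8 := Real.le_sqrt_of_sq_le (by norm_num)
  have hsum : p + q ≤ √8 := Real.le_sqrt_of_sq_le (by nlinarith [sq_nonneg (p - q)])
  rcases le_total (2 * r) p with h | h
  · have hP2 : (p - 2 * r) ^ 2 ≤ P ^ 2 := by
      have : 0 ≤ p - 2 * r := by linarith
      gcongr
    have := mul_le_mul_of_nonneg_left hsum hr
    nlinarith
  -- If `p < 2r` the lower bound on `P` may be negative and only `P² ≥ 0` is available. Then `p² ≤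
  -- 4r²` leaves `2r + q ≤ √8`, which holds since `2 · 0.36 + 2 < 2.8`.
  · have hq2 : q ≤ 2 := by nlinarith
    have hr2 : r ≤ 0.36 := by nlinarith
    nlinarith [sq_nonneg P]

variable {m n : ℕ}

/-- The bilinear form of `I - μ A* A`. -/
def residualForm (T : Vec n →ₗ[ℝ] Vec m) (μ : ℝ) (u v : Vec n) : ℝ :=
  inner ℝ u v - μ * inner ℝ (T u) (T v)

/-- Polarization: four times the form is `‖u+v‖² - ‖u-v‖²` minus the same expression for the images.
The two signs come from exchanging the roles of `u + v` and `u - v`. -/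
lemma abs_residualForm_le {T : Vec n →ₗ[ℝ] Vec m} {b b₀ : ℝ} (hb : 0 < b) (hb₀ : 0 ≤ b₀)
    (hbb : √8 * (b₀ / b) ≤ 1) {u v : Vec n} (hu : ‖u‖ ≤ 1) (hv : ‖v‖ ≤ 1)
    (h : ∀ t : ℝ, t = 1 ∨ t = -1 → |‖T (u + t • v)‖ - b * ‖u + t • v‖| ≤ 2 * b₀) :
    |residualForm T (1 / b ^ 2) u v| ≤ √8 * (b₀ / b) := by
  have h1 := abs_le.1 (h 1 (Or.inl rfl))
  have h2 := abs_le.1 (h (-1) (Or.inr rfl))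
  rw [one_smul] at h1
  rw [neg_one_smul, ← sub_eq_add_neg] at h2
  set r := b₀ / b with hr
  have hr0 : 0 ≤ r := by positivity
  have hbr : b₀ = b * r := by rw [hr]; field_simp
  have hpar : ‖u + v‖ ^ 2 + ‖u - v‖ ^ 2 ≤ 4 := by
    have := parallelogram_law_with_norm ℝ u v
    nlinarith [norm_nonneg u, norm_nonneg v]
  have low : ∀ {X p : ℝ}, -(2 * b₀) ≤ X - b * p → p - 2 * r ≤ X / b := fun h => by
    rw [le_div_iff₀ hb]; rw [hbr] at h; linarith
  have upp : ∀ {X p : ℝ}, X - b * p ≤ 2 * b₀ → X / b ≤ p + 2 * r := fun h => by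
    rw [div_le_iff₀ hb]; rw [hbr] at h; linarith
  have d1 : 0 ≤ ‖T (u + v)‖ / b := by positivity
  have d2 : 0 ≤ ‖T (u - v)‖ / b := by positivity
  have k1 := sq_sub_sq_le (norm_nonneg (u + v)) (norm_nonneg (u - v)) d2 hr0 hbb hpar
    (low h1.1) (upp h2.2)
  have k2 := sq_sub_sq_le (norm_nonneg (u - v)) (norm_nonneg (u + v)) d1 hr0 hbb
    (by linarith) (low h2.1) (upp h1.2)
  have e : 4 * residualForm T (1 / b ^ 2) u v = ‖u + v‖ ^ 2 - ‖u - v‖ ^ 2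
      - ((‖T (u + v)‖ / b) ^ 2 - (‖T (u - v)‖ / b) ^ 2) := by
    rw [residualForm, map_add, map_sub, div_pow, div_pow, norm_add_sq_real, norm_sub_sq_real,
      norm_add_sq_real, norm_sub_sq_real]
    field_simp
    ring
  rw [abs_le]
  constructor <;> linarith

lemma residualForm_smul_smul (T : Vec n →ₗ[ℝ] Vec m) (μ a b : ℝ) (u v : Vec n) :
    residualForm T μ (a • u) (b • v) = a * b * residualForm T μ u v := by
  simp only [residualForm, map_smul, inner_smul_left, inner_smul_right, conj_trivial]
  ring

/-- The residual bound on a cone follows from near isometry on its unit vectors. -/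
lemma abs_residualForm_le_of_cone {T : Vec n →ₗ[ℝ] Vec m} {b b₀ : ℝ} (hb : 0 < b) (hb₀ : 0 ≤ b₀)
    (hbb : √8 * (b₀ / b) ≤ 1) {C : Set (Vec n)} (hC : ∀ h ∈ C, ∀ t : ℝ, 0 ≤ t → t • h ∈ C)
    {x : Vec n}
    (h : ∀ u ∈ C ∩ Metric.closedBall 0 1, ∀ v ∈ insert (‖x‖⁻¹ • x) (C ∩ Metric.closedBall 0 1),
      ∀ t : ℝ, t = 1 ∨ t = -1 → |‖T (u + t • v)‖ - b * ‖u + t • v‖| ≤ 2 * b₀)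
    {u v : Vec n} (hu : u ∈ C) (hv : v ∈ insert x C) :
    |residualForm T (1 / b ^ 2) u v| ≤ √8 * (b₀ / b) * ‖u‖ * ‖v‖ := by
  have hnorm : ∀ u : Vec n, ‖‖u‖⁻¹ • u‖ ≤ 1 := fun u => by
    rw [norm_smul, norm_inv, norm_norm]
    exact inv_mul_le_one
  have hmul : ∀ u : Vec n, ‖u‖ • (‖u‖⁻¹ • u) = u := fun u => by
    rcases eq_or_ne u 0 with rfl | hu
    · simp
    · rw [smul_smul, mul_inv_cancel₀ (norm_ne_zero_iff.2 hu), one_smul]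
  have hmem : ∀ u ∈ C, ‖u‖⁻¹ • u ∈ C ∩ Metric.closedBall 0 1 := fun u hu =>
    ⟨hC u hu _ (by positivity), by simpa using hnorm u⟩
  have hv' : ‖v‖⁻¹ • v ∈ insert (‖x‖⁻¹ • x) (C ∩ Metric.closedBall 0 1) := by
    rcases mem_insert_iff.1 hv with rfl | hv
    · exact mem_insert _ _
    · exact mem_insert_of_mem _ (hmem v hv)
  have key := abs_residualForm_le hb hb₀ hbb (hnorm u) (hnorm v) (h _ (hmem u hu) _ hv')
  have e := residualForm_smul_smul T (1 / b ^ 2) ‖u‖ ‖v‖ (‖u‖⁻¹ • u) (‖v‖⁻¹ • v)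
  rw [hmul, hmul] at e
  rw [e, abs_mul, abs_of_nonneg (by positivity)]
  calc ‖u‖ * ‖v‖ * _ ≤ ‖u‖ * ‖v‖ * (√8 * (b₀ / b)) := by gcongr
    _ = _ := by ring

lemma inner_toEuclideanLin_transpose (A : Matrix (Fin m) (Fin n) ℝ) (u : Vec n) (y : Vec m) :
    inner ℝ u (Matrix.toEuclideanLin A.transpose y) = inner ℝ (Matrix.toEuclideanLin A u) y := by
  rw [← Matrix.conjTranspose_eq_transpose_of_trivial, Matrix.toEuclideanLin_conjTranspose_eq_adjoint,
    LinearMap.adjoint_inner_right]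

/-- Without noise, the error after the gradient step is `(I - μ A*A)(z - x)`. -/
lemma inner_gradient_step (A : Matrix (Fin m) (Fin n) ℝ) (μ : ℝ) (u z x : Vec n) :
    inner ℝ u (z + μ • Matrix.toEuclideanLin A.transpose
      (Matrix.toEuclideanLin A x - Matrix.toEuclideanLin A z) - x)
      = residualForm (Matrix.toEuclideanLin A) μ u (z - x) := by
  rw [residualForm, inner_sub_right, inner_add_right, inner_smul_right,
    inner_toEuclideanLin_transpose, map_sub, inner_sub_right, inner_sub_right, inner_sub_right]
  ring

end RestrictedBound

/-! ### One projection step and the recurrence -/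

section Projection

variable {n : ℕ} {K : Set (Vec n)}

lemma IsProj.inner_le_zero (hK : Convex ℝ K) {v p : Vec n} (h : IsProj K v p) :
    ∀ q ∈ K, inner ℝ (v - p) (q - p) ≤ 0 := by
  have hne : Nonempty K := ⟨⟨p, h.1⟩⟩
  refine (norm_eq_iInf_iff_real_inner_le_zero hK h.1).1 (le_antisymm
    (le_ciInf fun q => h.2 q q.2) ?_)
  exact ciInf_le ⟨0, by rintro _ ⟨q, rfl⟩; exact norm_nonneg _⟩ (⟨p, h.1⟩ : K)

lemma kappa_eq (f : Vec n → ℝ) : kappa f = 1 ∨ kappa f = 2 := by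
  unfold kappa
  split_ifs <;> simp

lemma convex_sublevel_of_kappa_eq_one {f : Vec n → ℝ} (h : kappa f = 1) (R : ℝ) :
    Convex ℝ {v | f v ≤ R} := by
  have hf : ConvexOn ℝ univ f := by
    by_contra hf
    simp [kappa, hf] at h
  simpa using hf.convex_le R

/-- One projection step, compared with the point `x` via a point `p` of the constraint set. -/
lemma IsProj.norm_sub_le {κ : ℝ} (hκ : κ = 1 ∨ κ = 2) (hK : κ = 1 → Convex ℝ K)
    {v z p x : Vec n} (h : IsProj K v z) (hp : p ∈ K) {a : ℝ} (ha : 0 ≤ a)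
    (h₁ : |inner ℝ (z - x) (v - x)| ≤ a * ‖z - x‖)
    (h₂ : |inner ℝ (p - x) (v - x)| ≤ a * ‖x - p‖) :
    ‖z - x‖ ≤ κ * a + (3 - κ) * ‖x - p‖ := by
  rw [norm_sub_rev x p] at *
  have hd := norm_nonneg (p - x)
  have l1 := (abs_le.1 h₁).2
  have l2 := (abs_le.1 h₂).1
  have e1 : v - z = (v - x) - (z - x) := by abel
  rcases hκ with rfl | rfl
  -- Convex case: with `u = z - x` and `q = p - x`, the obtuse angle condition yields `‖u‖² ≤ a ‖u‖
  -- + a ‖q‖ + ‖u‖ ‖q‖`, which forces `‖u‖ ≤ a + 2 ‖q‖`.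
  · have hi := h.inner_le_zero (hK rfl) p hp
    have e2 : p - z = (p - x) - (z - x) := by abel
    have l3 := real_inner_le_norm (z - x) (p - x)
    rw [e1, e2] at hi
    generalize z - x = u, v - x = e, p - x = q at *
    rw [inner_sub_left, inner_sub_right, inner_sub_right, real_inner_self_eq_norm_sq,
      real_inner_comm q e, real_inner_comm u e] at hi
    by_contra hcon
    push Not at hcon
    nlinarith
  -- Without convexity only minimality is available. Expanding squares gives `(‖u‖ - a)² ≤ (a +
  -- ‖q‖)²`, hence `‖u‖ ≤ 2a + ‖q‖`.
  · have hi := h.2 p hp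
    have hi2 : ‖v - z‖ ^ 2 ≤ ‖v - p‖ ^ 2 := by gcongr
    have e2 : v - p = (v - x) - (p - x) := by abel
    rw [e1, e2] at hi2
    generalize z - x = u, v - x = e, p - x = q at *
    rw [norm_sub_sq_real, norm_sub_sq_real, real_inner_comm u, real_inner_comm q] at hi2
    by_contra hcon
    push Not at hcon
    nlinarith

lemma linear_recurrence_le {X : ℕ → ℝ} {ρ D : ℝ} (hρ0 : 0 ≤ ρ) (hρ1 : ρ < 1)
    (h : ∀ τ, X (τ + 1) ≤ ρ * X τ + D) (τ : ℕ) :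
    X τ ≤ ρ ^ τ * X 0 + D * (1 - ρ ^ τ) / (1 - ρ) := by
  have h1 : 0 < 1 - ρ := by linarith
  induction τ with
  | zero => simp
  | succ k ih =>
    refine (h k).trans ((add_le_add (mul_le_mul_of_nonneg_left ih hρ0) le_rfl).trans (le_of_eq ?_))
    rw [pow_succ]
    field_simp
    ring

end Projection

/-! ### Convergence of the iteration -/

section Convergence

variable {m n : ℕ} {f : Vec n → ℝ} {x : Vec n} {A : Matrix (Fin m) (Fin n) ℝ} {μ a₀ ρ R : ℝ}
  {z : ℕ → Vec n}

/-- Convergence for a sublevel set not containing the signal. -/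
theorem IsPGD.norm_sub_le_of_lt
    (hform : ∀ u ∈ tangentCone f x, ∀ v ∈ insert (-x) (tangentCone f x),
      |residualForm (Matrix.toEuclideanLin A) μ u v| ≤ a₀ * ‖u‖ * ‖v‖)
    (ha₀ : 0 ≤ a₀) (haρ : kappa f * a₀ ≤ ρ) (hρ0 : 0 ≤ ρ) (hρ1 : ρ < 1) (hR : R < f x)
    (hz : IsPGD A (Matrix.toEuclideanLin A x) μ {v | f v ≤ R} z) {p : Vec n}
    (hp : IsProj {v | f v ≤ R} x p) (τ : ℕ) :
    ‖z τ - x‖ ≤ ρ ^ τ * ‖x‖ + (3 - kappa f) / (1 - ρ) * ‖x - p‖ := by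
  have hmem : ∀ q : Vec n, f q ≤ R → q - x ∈ tangentCone f x := fun q hq =>
    sub_mem_tangentCone (hq.trans hR.le)
  -- At `τ = 0` the error is `-x`, since the starting point `0` need not be in the constraint set;
  -- hence the extra vector in `hform`.
  have hzmem : ∀ τ, z τ - x ∈ insert (-x) (tangentCone f x) := fun τ => by
    cases τ with
    | zero => rw [hz.1, zero_sub]; exact mem_insert _ _
    | succ k => exact mem_insert_of_mem _ (hmem _ (hz.2 k).1)
  have hpx : ‖p - x‖ = ‖x - p‖ := norm_sub_rev _ _
  have hstep : ∀ τ, ‖z (τ + 1) - x‖ ≤ ρ * ‖z τ - x‖ + (3 - kappa f) * ‖x - p‖ := fun τ => by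
    refine ((hz.2 τ).norm_sub_le (x := x) (kappa_eq f)
      (fun h => convex_sublevel_of_kappa_eq_one h R) hp.1
      (a := a₀ * ‖z τ - x‖) (by positivity) ?_ ?_).trans ?_
    · rw [inner_gradient_step]
      refine (hform _ (hmem _ (hz.2 τ).1) _ (hzmem τ)).trans (le_of_eq (by ring))
    · rw [inner_gradient_step]
      refine (hform _ (hmem _ hp.1) _ (hzmem τ)).trans (le_of_eq (by rw [hpx]; ring))
    · rw [← mul_assoc]
      gcongr
  refine (linear_recurrence_le (X := fun τ => ‖z τ - x‖) hρ0 hρ1 hstep τ).trans ?_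
  have h1 : 0 < 1 - ρ := by linarith
  have h3 : 0 ≤ (3 - kappa f) * ‖x - p‖ := by
    rcases kappa_eq f with h | h <;> norm_num [h]
  have h4 : 0 ≤ ρ ^ τ := by positivity
  rw [hz.1, zero_sub, norm_neg, div_mul_eq_mul_div]
  refine add_le_add le_rfl ((div_le_div_iff_of_pos_right h1).2 ?_)
  nlinarith

/-- Convergence for a sublevel set of too high a level. -/
theorem IsPGD.norm_sub_le_of_gt (hf : AbsHomogeneous f) (hx : 0 < f x)
    (hform : ∀ u ∈ tangentCone f x, ∀ v ∈ insert (-x) (tangentCone f x),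
      |residualForm (Matrix.toEuclideanLin A) μ u v| ≤ a₀ * ‖u‖ * ‖v‖)
    (ha₀ : 0 ≤ a₀) (haρ : kappa f * a₀ ≤ ρ) (hρ0 : 0 ≤ ρ) (hρ1 : ρ < 1) (hR : f x < R)
    (hz : IsPGD A (Matrix.toEuclideanLin A x) μ {v | f v ≤ R} z) (τ : ℕ) :
    ‖z τ - x‖ ≤ ρ ^ τ * ‖x‖ + (kappa f + 1 + 2 * ρ) / (1 - ρ) * (R / f x - 1) * ‖x‖ := by
  set c := R / f x with hc
  have hc1 : 1 < c := by rwa [hc, one_lt_div hx]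
  have hc0 : 0 < c := by linarith
  have hfc : f (c • x) = R := by rw [hf, abs_of_pos hc0, hc, div_mul_cancel₀ _ hx.ne']
  set x' := c • x with hx'
  have hmem : ∀ q : Vec n, f q ≤ R → q - x' ∈ tangentCone f x := fun q hq => by
    rw [← hf.tangentCone_smul hc0 x]
    exact sub_mem_tangentCone (hq.trans_eq hfc.symm)
  have hzmem : ∀ τ, z τ - x' ∈ tangentCone f x := fun τ => by
    cases τ with
    | zero => rw [hz.1]; exact hmem 0 (by rw [hf.map_zero]; linarith)
    | succ k => exact hmem _ (hz.2 k).1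
  have hΔ : ‖x' - x‖ = (c - 1) * ‖x‖ := by
    have : x' - x = (c - 1) • x := by rw [hx', sub_smul, one_smul]
    rw [this, norm_smul, Real.norm_of_nonneg (by linarith)]
  -- The reference point `x'` belongs to the constraint set, so `p = x'` leaves no distance term.
  -- The mismatch between `x'` and the true signal `x` goes into `a` instead.
  have hstep : ∀ τ, ‖z (τ + 1) - x'‖ ≤ ρ * ‖z τ - x'‖ + (ρ + kappa f) * ‖x' - x‖ := fun τ => by
    refine ((hz.2 τ).norm_sub_le (x := x') (p := x') (kappa_eq f)
      (fun h => convex_sublevel_of_kappa_eq_one h R) (show f x' ≤ R from hfc.le)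
      (a := a₀ * ‖z τ - x'‖ + a₀ * ‖x' - x‖ + ‖x' - x‖) (by positivity) ?_ (by simp)).trans ?_
    · set u := z (τ + 1) - x' with hu
      have hu' : u ∈ tangentCone f x := hmem _ (hz.2 τ).1
      set v := z τ + μ • Matrix.toEuclideanLin A.transpose
        (Matrix.toEuclideanLin A x - Matrix.toEuclideanLin A (z τ)) with hv
      -- The gradient step is centered at `x`, so `z τ - x` is split into an element of the cone and
      -- a multiple of `x`; the form on the latter is controlled through `-x`.
      have e : inner ℝ u (v - x') = residualForm (Matrix.toEuclideanLin A) μ u (z τ - x')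
          + residualForm (Matrix.toEuclideanLin A) μ u ((c - 1) • x) - inner ℝ u (x' - x) := by
        have e1 : v - x' = (v - x) - (x' - x) := by abel
        have e2 : z τ - x = (z τ - x') + (c - 1) • x := by
          rw [hx', sub_smul, one_smul]; abel
        rw [e1, inner_sub_right, inner_gradient_step, e2]
        simp only [residualForm, map_add, inner_add_right]
        ring
      have b1 := hform u hu' _ (mem_insert_of_mem _ (hzmem τ))
      have b2 := hform u hu' (-x) (mem_insert _ _)
      have e3 : residualForm (Matrix.toEuclideanLin A) μ u ((c - 1) • x)
          = -((c - 1) * residualForm (Matrix.toEuclideanLin A) μ u (-x)) := by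
        have := residualForm_smul_smul (Matrix.toEuclideanLin A) μ 1 (-(c - 1)) u (-x)
        rw [one_smul, neg_smul, smul_neg, neg_neg] at this
        rw [this]; ring
      have b3 : |residualForm (Matrix.toEuclideanLin A) μ u ((c - 1) • x)|
          ≤ a₀ * ‖x' - x‖ * ‖u‖ := by
        rw [e3, abs_neg, abs_mul, abs_of_pos (by linarith : 0 < c - 1), hΔ]
        rw [norm_neg] at b2
        calc _ ≤ (c - 1) * (a₀ * ‖u‖ * ‖x‖) := by
              have : 0 ≤ c - 1 := by linarith
              gcongr
          _ = _ := by ring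
      have b4 := abs_real_inner_le_norm u (x' - x)
      rw [e]
      calc _ ≤ |residualForm (Matrix.toEuclideanLin A) μ u (z τ - x')|
            + |residualForm (Matrix.toEuclideanLin A) μ u ((c - 1) • x)|
            + |inner ℝ u (x' - x)| :=
            (abs_sub _ _).trans (add_le_add (abs_add_le _ _) le_rfl)
        _ ≤ a₀ * ‖u‖ * ‖z τ - x'‖ + a₀ * ‖x' - x‖ * ‖u‖ + ‖u‖ * ‖x' - x‖ := by gcongr
        _ = _ := by ring
    · rw [sub_self, norm_zero, mul_zero, add_zero]
      have h1 := mul_le_mul_of_nonneg_right haρ (norm_nonneg (z τ - x'))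
      have h2 := mul_le_mul_of_nonneg_right haρ (norm_nonneg (x' - x))
      linarith
  have hrec := linear_recurrence_le (X := fun τ => ‖z τ - x'‖) hρ0 hρ1 hstep τ
  have h0 : ‖z 0 - x'‖ = c * ‖x‖ := by
    rw [hz.1, zero_sub, norm_neg, hx', norm_smul, Real.norm_of_nonneg hc0.le]
  have htri : ‖z τ - x‖ ≤ ‖z τ - x'‖ + ‖x' - x‖ := norm_sub_le_norm_sub_add_norm_sub _ _ _
  have h1 : 0 < 1 - ρ := by linarith
  have hκ1 : 1 ≤ kappa f := by rcases kappa_eq f with h | h <;> norm_num [h]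
  have hpow : 0 ≤ ρ ^ τ := by positivity
  simp only [h0] at hrec
  rw [hΔ] at hrec htri
  set Δ := (c - 1) * ‖x‖ with hΔdef
  have hΔ0 : 0 ≤ Δ := mul_nonneg (by linarith) (norm_nonneg _)
  -- `Δ` appears three times: in the initial error `c ‖x‖ = ‖x‖ + Δ`, in the recurrence, and in
  -- returning from `x'` to `x`. The total coefficient of `ρ ^ τ` is nonpositive because `κ ≥ 1`, so
  -- it is dropped; the slack `2ρ` is not tight.
  have hfin : ρ ^ τ * Δ + (ρ + kappa f) * Δ * (1 - ρ ^ τ) / (1 - ρ) + Δ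
      ≤ (kappa f + 1 + 2 * ρ) / (1 - ρ) * Δ := by
    have e : ρ ^ τ * Δ + (ρ + kappa f) * Δ * (1 - ρ ^ τ) / (1 - ρ) + Δ
        = (1 + kappa f + ρ ^ τ * (1 - 2 * ρ - kappa f)) / (1 - ρ) * Δ := by
      field_simp
      ring
    rw [e]
    refine mul_le_mul_of_nonneg_right ((div_le_div_iff_of_pos_right h1).2 ?_) hΔ0
    have : ρ ^ τ * (1 - 2 * ρ - kappa f) ≤ 0 :=
      mul_nonpos_of_nonneg_of_nonpos hpow (by linarith)
    linarith
  have e5 : c * ‖x‖ = ‖x‖ + Δ := by rw [hΔdef]; ring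
  rw [e5] at hrec
  rw [mul_assoc ((kappa f + 1 + 2 * ρ) / (1 - ρ))]
  linarith

end Convergence

/-! ### The rate, and assembly of the theorem -/

/-- Since `m₀ ≤ m`, monotonicity of `φ(t)² / t` gives `φ(m₀) / φ(m) ≤ √(m₀ / m)`, and `8 κ² m₀ < m`
is exactly `ρ² < 1`. -/
lemma rate_bounds {κ m₀ b₀ : ℝ} {m : ℕ} (hκ : κ = 1 ∨ κ = 2) (hm₀ : 0 ≤ m₀) (hb₀ : phi m₀ = b₀)
    (hm : 8 * κ ^ 2 * m₀ < m) :
    0 < m ∧ 0 ≤ rate κ m₀ m ∧ rate κ m₀ m < 1 ∧ κ * (√8 * (b₀ / phi m)) ≤ rate κ m₀ m := by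
  have hκ1 : 1 ≤ κ := by rcases hκ with h | h <;> norm_num [h]
  have hm0 : (0 : ℝ) < m := lt_of_le_of_lt (by positivity) hm
  have hmm : m₀ ≤ m := by nlinarith [sq_nonneg (κ - 1), mul_nonneg hm₀ (sq_nonneg κ)]
  have hφ := phi_pos hm0
  refine ⟨by exact_mod_cast hm0, by unfold rate; positivity, ?_, ?_⟩
  · have h1 : rate κ m₀ m ^ 2 < 1 := by
      rw [rate, mul_pow, mul_pow, Real.sq_sqrt (by norm_num), Real.sq_sqrt (by positivity),
        ← mul_div_assoc, div_lt_one hm0]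
      exact hm
    nlinarith [show 0 ≤ rate κ m₀ m by unfold rate; positivity]
  · have h2 : b₀ / phi m ≤ √(m₀ / m) := by
      refine Real.le_sqrt_of_sq_le ?_
      rw [div_pow, div_le_div_iff₀ (by positivity) hm0, ← hb₀, mul_comm m₀]
      exact phi_sq_mul_le hm₀ hmm hm0
    rw [rate]
    calc _ = √8 * κ * (b₀ / phi m) := by ring
      _ ≤ _ := by gcongr

end PGD

end

theorem theorem6 {Ω : Type*} [MeasurableSpace Ω] (P : Measure Ω) [IsProbabilityMeasure P]
    (m n : ℕ) (A : Ω → Matrix (Fin m) (Fin n) ℝ) (hA : PGD.IsGaussianMap P A)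
    (f : PGD.Vec n → ℝ) (hf : PGD.IsProperFun f) (x : PGD.Vec n)
    (η : ℝ) (hη : 0 ≤ η)
    (hm : 8 * PGD.kappa f ^ 2 * PGD.phaseTransition f x η < (m : ℝ)) :
    -- underestimated level
    (∃ E : Set Ω, MeasurableSet E ∧ 1 - 8 * Real.exp (-η ^ 2 / 8) ≤ P.real E ∧
      ∀ ω ∈ E, ∀ R : ℝ, R < f x → ∀ z : ℕ → PGD.Vec n,
        PGD.IsPGD (A ω) (Matrix.toEuclideanLin (A ω) x) (1 / PGD.phi m ^ 2)
          {v | f v ≤ R} z →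
        ∀ p : PGD.Vec n, PGD.IsProj {v | f v ≤ R} x p → ∀ τ : ℕ,
          ‖z τ - x‖ ≤
            PGD.rate (PGD.kappa f) (PGD.phaseTransition f x η) m ^ τ * ‖x‖ +
            (3 - PGD.kappa f) / (1 - PGD.rate (PGD.kappa f) (PGD.phaseTransition f x η) m) *
              ‖x - p‖) ∧
    -- overestimated level
    (PGD.AbsHomogeneous f → 0 < f x →
      ∃ E : Set Ω, MeasurableSet E ∧ 1 - 8 * Real.exp (-η ^ 2 / 8) ≤ P.real E ∧
      ∀ ω ∈ E, ∀ R : ℝ, f x < R → ∀ z : ℕ → PGD.Vec n,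
        PGD.IsPGD (A ω) (Matrix.toEuclideanLin (A ω) x) (1 / PGD.phi m ^ 2)
          {v | f v ≤ R} z →
        ∀ ρ : ℝ, ρ = PGD.rate (PGD.kappa f) (PGD.phaseTransition f ((R / f x) • x) η) m →
        ∀ τ : ℕ,
          ‖z τ - x‖ ≤ ρ ^ τ * ‖x‖ +
            (PGD.kappa f + 1 + 2 * ρ) / (1 - ρ) * (R / f x - 1) * ‖x‖) ∧
    -- if `f` is a norm, the phase transition at the rescaled signal is the original one
    (PGD.AbsHomogeneous f → (∀ u v, f (u + v) ≤ f u + f v) → (∀ v, f v = 0 → v = 0) →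
      x ≠ 0 → ∀ R : ℝ, f x < R →
        PGD.phaseTransition f ((R / f x) • x) η = PGD.phaseTransition f x η) := by
  set C := PGD.tangentCone f x with hC
  set K := C ∩ Metric.closedBall 0 1 with hK
  have hKb : K ⊆ Metric.closedBall 0 1 := inter_subset_right
  have h0 : (0 : PGD.Vec n) ∈ K := ⟨PGD.zero_mem_tangentCone f x, by simp⟩
  set b₀ := PGD.gaussianWidth K + η with hb₀
  have hb₀0 : 0 ≤ b₀ := add_nonneg (PGD.gaussianWidth_nonneg hKb h0) hη
  set m₀ := PGD.phaseTransition f x η with hm₀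
  obtain ⟨hmpos, hρ0, hρ1, hrate⟩ := PGD.rate_bounds (PGD.kappa_eq f) (PGD.phiInv_nonneg hb₀0)
    (PGD.phi_phiInv hb₀0) hm
  have hφ : 0 < PGD.phi m := PGD.phi_pos (by exact_mod_cast hmpos)
  set a₀ := √8 * (b₀ / PGD.phi m) with ha₀
  have ha₀0 : 0 ≤ a₀ := by positivity
  have hκ1 : 1 ≤ PGD.kappa f := by rcases PGD.kappa_eq f with h | h <;> norm_num [h]
  have ha₀1 : a₀ ≤ 1 := (le_mul_of_one_le_left ha₀0 hκ1).trans (hrate.trans hρ1.le)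
  -- An inequality rather than an equality, so that `x = 0`, where the normalized vector is `0`,
  -- needs no separate case.
  have hv : ‖‖-x‖⁻¹ • (-x)‖ ≤ 1 := by
    rw [norm_smul, norm_inv, norm_norm]
    exact inv_mul_le_one
  obtain ⟨E, hE, hPE, hgood⟩ := PGD.exists_nearIsometry_event P hA hmpos hKb h0 hv η hη
  have hform : ∀ ω ∈ E, ∀ u ∈ C, ∀ v ∈ insert (-x) C,
      |PGD.residualForm (Matrix.toEuclideanLin (A ω)) (1 / PGD.phi m ^ 2) u v|
        ≤ a₀ * ‖u‖ * ‖v‖ := fun ω hω u hu v hv =>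
    PGD.abs_residualForm_le_of_cone hφ hb₀0 ha₀1
      (fun h hh t ht => PGD.smul_mem_tangentCone hh ht)
      (fun u hu v hv t ht => (hgood ω hω u hu v hv t ht).trans (by rw [hb₀]; linarith)) hu hv
  refine ⟨⟨E, hE, hPE, fun ω hω R hR z hz p hp τ =>
    hz.norm_sub_le_of_lt (hform ω hω) ha₀0 hrate hρ0 hρ1 hR hp τ⟩, fun hh hx => ⟨E, hE, hPE,
    fun ω hω R hR z hz ρ hρ τ => ?_⟩, fun hh hadd hdef hx R hR => ?_⟩
  -- Homogeneity makes `m₀'` equal to `m₀` for every `R`, so the rate is the one already bounded and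
  -- the same event applies.
  · rw [hh.phaseTransition_smul (div_pos (hx.trans hR) hx)] at hρ
    subst hρ
    exact hz.norm_sub_le_of_gt hh hx (hform ω hω) ha₀0 hrate hρ0 hρ1 hR τ
  · have hx0 := hh.pos_of_ne_zero hadd hdef hx
    exact hh.phaseTransition_smul (div_pos (hx0.trans hR) hx0) x η
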